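/- **Structure theorem for multi-marginal entropic optimal transport.** Let $D\ge 1$, let $\Theta_1,\dots,\Theta_D$ be measurable spaces with probability measures $m_1,\dots,m_D$, put $\Theta=\prod_{i=1}^D\Theta_i$ and $m=\bigotimes_{i=1}^D m_i$, and let $\mathcal C(m)$ be the set of couplings, that is, of probability measures $q$ on $\Theta$ whose $i$-th marginal is $q_i=m_i$ for every $i$. Let $\ell:\Theta\to\mathbb R$ (the log-likelihood of the data) be measurable, let $\lambda\ge 0$, and let $\Xi(q)=D_{\mathrm{KL}}\bigl(q\,\|\,\bigotimes_i q_i\bigr)$. Assume $$\inf_{q\in\mathcal C(m)}\bigl\{\mathbb E_q[-\ell]+(\lambda+1)\,\Xi(q)\bigr\}<\infty\qquad\text{and}\qquad \sup_{\theta\in\Theta}\ell(\theta)<\infty .$$ (Here $\mathbb E_q[-\ell]\in(-\infty,\infty]$.) Then the inner variational problem $$\min_{q\in\mathcal C(m)}\ \mathbb E_q[-\ell]+(\lambda+1)\,D_{\mathrm{KL}}(q\,\|\,m)$$ has a unique minimizer $q^*$, it satisfies $q^*\ll m$, and the following hold. 1. There are measurable functions $\phi_i^*:\Theta_i\to\mathbb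 R$, $i=1,\dots,D$ (EOT potentials), such that $$\frac{dq^*}{dm}(\theta)=\exp\Bigl(\sum_{i=1}^D\phi_i^*(\theta_i)+\frac1{\lambda+1}\,\ell(\theta)\Bigr)\qquad m\text{-almost surely.}\tag{$*$}$$ They are unique up to additive constants: if functions $\phi_i:\Theta_i\to\mathbb R$ also satisfy $(*)$, then there are constants $c_i$ with $\sum_i c_i=0$ and $\phi_i=\phi_i^*+c_i$ $m_i$-almost surely for every $i$. If moreover $\inf_{\theta\in\Theta}\ell(\theta)>-\infty$, then every family of potentials satisfies $\phi_i\in L^\infty(m_i)$ for all $i$ (whatever the normalization). 2. Conversely, let $q\in\mathcal C(m)$ with $q\ll m$ have, $m$-almost surely, the density $\exp\bigl(\sum_i\phi_i(\theta_i)+\frac1{\lambda+1}\ell(\theta)\bigr)$ for some functions $\phi_i:\Theta_i\to\mathbb R$, and suppose that $\phi_i\in L^1(m_i)$ for all $i$, or that $\inf_\Theta\ell>-\infty$, or that $D\le 2$. Then $q$ minimizes the inner variational problem, and the $\phi_i$ are the EOT potentials, i.e. $\phi_i=\phi_i^*+c_i$ $m_i$-almost surely for constants $c_i$ with $\sum_i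 c_i=0$. -/

import Mathlib

open MeasureTheory InformationTheory
open scoped ENNReal

noncomputable section

namespace XiVI

/-- The expectation `E_q[f]` of a real function as an extended real number,
`E_q[f⁺] - E_q[f⁻]`. It is the usual expectation whenever one of the two parts is finite, in
particular when `f` is bounded below and `q` is finite; it is then `⊤` if `E_q[f⁺] = ∞`. -/
def extMean {Ω : Type*} [MeasurableSpace Ω] (q : Measure Ω) (f : Ω → ℝ) : EReal :=
  ((∫⁻ ω, ENNReal.ofReal (f ω) ∂q : ℝ≥0∞) : EReal)
    - ((∫⁻ ω, ENNReal.ofReal (-f ω) ∂q : ℝ≥0∞) : EReal)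

variable {D : ℕ} {Θ : Fin D → Type*} [∀ i, MeasurableSpace (Θ i)]

/-- The `i`-th marginal of a measure on the product space. -/
def marginal (q : Measure (∀ i, Θ i)) (i : Fin D) : Measure (Θ i) :=
  q.map (fun θ => θ i)

/-- The couplings of `m 0, …, m (D - 1)`: the probability measures with these marginals. -/
def couplings (m : ∀ i, Measure (Θ i)) : Set (Measure (∀ i, Θ i)) :=
  {q | IsProbabilityMeasure q ∧ ∀ i, marginal q i = m i}

/-- The expressivity functional: the Kullback-Leibler divergence of `q` from the product of its
own marginals. -/
def expressivity (q : Measure (∀ i, Θ i)) : ℝ≥0∞ :=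
  klDiv q (Measure.pi (marginal q))

/-- The objective `E_q[-ℓ] + (lam + 1) KL(q ‖ m)` of the inner variational problem, where the
product measure is `m = ∏ i, m i`. -/
def innerObjective (m : ∀ i, Measure (Θ i)) (ℓ : (∀ i, Θ i) → ℝ) (lam : ℝ)
    (q : Measure (∀ i, Θ i)) : EReal :=
  extMean q (fun θ => -ℓ θ)
    + ((ENNReal.ofReal (lam + 1) * klDiv q (Measure.pi m) : ℝ≥0∞) : EReal)

/-- `q` is a minimizer of the inner variational problem over the couplings of the `m i`. -/
def IsInnerMinimizer (m : ∀ i, Measure (Θ i)) (ℓ : (∀ i, Θ i) → ℝ) (lam : ℝ)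
    (q : Measure (∀ i, Θ i)) : Prop :=
  q ∈ couplings m ∧ IsMinOn (innerObjective m ℓ lam) (couplings m) q

/-- `q` is absolutely continuous with respect to the product measure `m = ∏ i, m i`, with density
`exp (∑ i, φ i (θ i) + ℓ θ / (lam + 1))`, `m`-almost surely. The `φ i` are arbitrary real
functions. -/
def HasPotentials (m : ∀ i, Measure (Θ i)) (ℓ : (∀ i, Θ i) → ℝ) (lam : ℝ)
    (q : Measure (∀ i, Θ i)) (φ : ∀ i, Θ i → ℝ) : Prop :=
  q ≪ Measure.pi m ∧
    ∀ᵐ θ ∂(Measure.pi m), q.rnDeriv (Measure.pi m) θ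
      = ENNReal.ofReal (Real.exp (∑ i, φ i (θ i) + 1 / (lam + 1) * ℓ θ))

/-- `φ` and `ψ` agree up to additive constants: `φ i = ψ i + c i`, `m i`-almost surely, where
the constants `c i` sum to zero. -/
def EqUpToConstants (m : ∀ i, Measure (Θ i)) (φ ψ : ∀ i, Θ i → ℝ) : Prop :=
  ∃ c : Fin D → ℝ, ∑ i, c i = 0 ∧ ∀ i, ∀ᵐ t ∂(m i), φ i t = ψ i t + c i

end XiVI

end

/-!
With `c = (M - ℓ) / (lam + 1) ≥ 0`, where `M ≥ 0` is an upper bound of `ℓ`, the objective of a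
coupling with density `f` is `(lam + 1) * energy m c f - M`, where
`energy m c f = ∫ (c f + f log f + 1 - f) dm`; couplings without density have infinite objective.
So everything is a statement about the convex functional `energy` on the densities of couplings.

*Existence and uniqueness.* The energy is uniformly convex for the Hellinger distance
(`energy_midpoint_add_le`). Hence minimizing sequences are Cauchy in `L¹`, their limits are optimal
by Fatou's lemma (`exists_isOptimalDensity`), and optimal densities are unique
(`IsOptimalDensity.ae_eq`).

*Potentials.* Take `D` points `ω 0, …, ω (D - 1)` of the product space and exchange their
coordinates cyclically: `shear ω k` has the `i`-th coordinate of `ω (k + i)`. When `ω` is a sample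
of independent points from `m`, restricted to a set where `c` and `f` are bounded, removing a little
mass at the `ω k` and adding it at the `shear ω k` changes `f` by a bounded amount and keeps all
marginals (`exists_isAdmissibleDirection`). Optimality of `f` under these variations has two
consequences. First, `f > 0` almost everywhere: independent samples of the optimal coupling have
exchanged points distributed according to `m`, so an exchange would reach the zero set of `f`, where
the entropy has slope `-∞` (`IsOptimalDensity.ae_pos`). Second, for `Z = log f + c` one gets
`∑ k, Z (ω k) ≤ ∑ k, Z (shear ω k)` almost everywhere; since `shear` preserves the measure, equality
holds. As the point `shear ω 0 = (ω i i)_i` takes from each `ω i` one coordinate that enters no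
other `shear ω k`, freezing the remaining coordinates exhibits `Z` as a sum of functions of single
coordinates (`exists_ae_eq_sum_of_shear_invariant`). No closedness theorem for sums of functions is
needed.

*Uniqueness and boundedness of potentials.* Both come from resampling a single coordinate
(`exists_const_of_sum_eq_zero`, `IsCouplingDensity.exists_bound_potential`).

*Converse.* If the potentials are integrable, `∑ i, φ i` has the same integral against all
couplings, and convexity gives optimality (`IsCouplingDensity.isOptimalDensity`); bounded `ℓ`
reduces to this case. For `D ≤ 2` the function `∑ i, arctan (φ i - ψ i)`, with `ψ` the optimal
potentials, is bounded and has the sign of the difference of the two densities, against which it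
integrates to zero (`IsCouplingDensity.ae_eq_of_le_two`).
-/

noncomputable section

namespace XiVI

/-! ### Product measures -/

section Product

variable {ι : Type*} [Fintype ι] {X : ι → Type*} [∀ i, MeasurableSpace (X i)]
  (μ : ∀ i, Measure (X i)) [∀ i, IsProbabilityMeasure (μ i)]

lemma map_pi_eval (i : ι) : (Measure.pi μ).map (fun x => x i) = μ i := by
  classical
  have := Measure.pi_map_eval μ i
  simpa [Function.eval] using this

/-- Resampling one coordinate independently preserves a product measure. -/
lemma measurePreserving_update [DecidableEq ι] (i : ι) :
    MeasurePreserving (fun p : (∀ j, X j) × X i => Function.update p.1 i p.2)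
      ((Measure.pi μ).prod (μ i)) (Measure.pi μ) := by
  have hm : Measurable (fun p : (∀ j, X j) × X i => Function.update p.1 i p.2) := by
    refine measurable_pi_iff.2 fun j => ?_
    by_cases h : j = i
    · subst h; simpa using measurable_snd
    · simp only [Function.update_of_ne h]; fun_prop
  refine ⟨hm, (Measure.pi_eq fun s hs => ?_).symm⟩
  rw [Measure.map_apply hm (MeasurableSet.univ_pi hs)]
  have : (fun p : (∀ j, X j) × X i => Function.update p.1 i p.2) ⁻¹' (Set.univ.pi s)
      = (Set.univ.pi (Function.update s i Set.univ)) ×ˢ (s i) := by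
    ext p
    simp only [Set.mem_preimage, Set.mem_pi, Set.mem_univ, true_implies, Set.mem_prod]
    constructor
    · intro h
      refine ⟨fun j => ?_, by simpa using h i⟩
      by_cases hj : j = i
      · subst hj; simp
      · simpa [Function.update_of_ne hj] using h j
    · rintro ⟨h, h'⟩ j
      by_cases hj : j = i
      · subst hj; simpa using h'
      · simpa [Function.update_of_ne hj] using h j
  rw [this, Measure.prod_prod, Measure.pi_pi, ← Finset.prod_erase_mul _ _ (Finset.mem_univ i),
    ← Finset.prod_erase_mul (a := i) Finset.univ (fun j => μ j (s j)) (Finset.mem_univ i)]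
  congr 1
  rw [Function.update_self, measure_univ, mul_one]
  refine Finset.prod_congr rfl fun j hj => ?_
  rw [Function.update_of_ne (Finset.ne_of_mem_erase hj)]

/-- Absolutely continuous probability measures have absolutely continuous products: the product
of the densities is a density. -/
lemma pi_absolutelyContinuous {ν : ∀ i, Measure (X i)} [∀ i, IsProbabilityMeasure (ν i)]
    (h : ∀ i, ν i ≪ μ i) : Measure.pi ν ≪ Measure.pi μ := by
  have key : Measure.pi ν
      = (Measure.pi μ).withDensity (fun x => ∏ i, (ν i).rnDeriv (μ i) (x i)) := by
    refine Measure.pi_eq fun s hs => ?_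
    rw [withDensity_apply _ (MeasurableSet.univ_pi hs),
      ← lintegral_indicator (MeasurableSet.univ_pi hs)]
    have hX : ∀ i, Measurable ((s i).indicator ((ν i).rnDeriv (μ i))) := fun i =>
      (Measure.measurable_rnDeriv _ _).indicator (hs i)
    have h1 : ∀ x : ∀ i, X i, (Set.univ.pi s).indicator
        (fun x => ∏ i, (ν i).rnDeriv (μ i) (x i)) x
        = ∏ i, (s i).indicator ((ν i).rnDeriv (μ i)) (x i) := by
      intro x
      by_cases hx : x ∈ Set.univ.pi s
      · rw [Set.indicator_of_mem hx]
        exact Finset.prod_congr rfl fun i _ =>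
          (Set.indicator_of_mem (hx i (Set.mem_univ i)) _).symm
      · rw [Set.indicator_of_notMem hx]
        simp only [Set.mem_pi, Set.mem_univ, true_implies, not_forall] at hx
        obtain ⟨i, hi⟩ := hx
        exact (Finset.prod_eq_zero (Finset.mem_univ i) (Set.indicator_of_notMem hi _)).symm
    simp_rw [h1]
    rw [ProbabilityTheory.lintegral_prod_eq_prod_lintegral_of_indepFun Finset.univ
      (fun i (x : ∀ i, X i) => (s i).indicator ((ν i).rnDeriv (μ i)) (x i))
      (ProbabilityTheory.iIndepFun_pi fun i => (hX i).aemeasurable)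
      (fun i => (hX i).comp (measurable_pi_apply i))]
    refine Finset.prod_congr rfl fun i _ => ?_
    rw [MeasurePreserving.lintegral_comp ⟨measurable_pi_apply i, map_pi_eval μ i⟩ (hX i),
      lintegral_indicator (hs i), Measure.setLIntegral_rnDeriv (h i)]
  rw [key]
  exact withDensity_absolutelyContinuous _ _

end Product

/-! ### Exchanging coordinates between independent samples -/

section Transversal

variable {ι : Type*} [Fintype ι] {X : ι → Type*} [∀ i, MeasurableSpace (X i)]

/-- Among independent samples of a coupling, a point that takes each of its coordinates from a
different sample is distributed according to the product of the marginals. -/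
lemma measurePreserving_transversal {q : Measure (∀ i, X i)} [IsProbabilityMeasure q]
    {m : ∀ i, Measure (X i)} [∀ i, IsProbabilityMeasure (m i)]
    (hq : ∀ i, q.map (fun x => x i) = m i) (σ : Equiv.Perm ι) :
    MeasurePreserving (fun (ω : ι → ∀ i, X i) i => ω (σ i) i)
      (Measure.pi fun _ : ι => q) (Measure.pi m) := by
  have hm : Measurable (fun (ω : ι → ∀ i, X i) i => ω (σ i) i) := by fun_prop
  refine ⟨hm, (Measure.pi_eq fun s hs => ?_).symm⟩
  rw [Measure.map_apply hm (MeasurableSet.univ_pi hs)]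
  have : (fun (ω : ι → ∀ i, X i) i => ω (σ i) i) ⁻¹' (Set.univ.pi s)
      = Set.univ.pi (fun k => {x : ∀ i, X i | x (σ.symm k) ∈ s (σ.symm k)}) := by
    ext ω
    simp only [Set.mem_preimage, Set.mem_pi, Set.mem_univ, true_implies, Set.mem_ofPred_eq]
    constructor
    · intro h k; simpa using h (σ.symm k)
    · intro h i
      have := h (σ i)
      rwa [Equiv.symm_apply_apply] at this
  rw [this, Measure.pi_pi, ← Equiv.prod_comp σ]
  refine Finset.prod_congr rfl fun i _ => ?_
  rw [← hq i, Measure.map_apply (measurable_pi_apply i) (hs i), Equiv.symm_apply_apply]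
  rfl

variable [AddCommGroup ι]

/-- The cyclic exchange of coordinates between samples `ω k` indexed by a group `ι`: the `i`-th
coordinate of the `k`-th new point is that of the sample `k + i`. Each coordinate of the samples
is used exactly once. -/
def shear (ω : ι → ∀ i, X i) : ι → ∀ i, X i := fun k i => ω (k + i) i

omit [Fintype ι] in
lemma measurable_shear : Measurable (shear : (ι → ∀ i, X i) → ι → ∀ i, X i) := by
  unfold shear; fun_prop

lemma measurePreserving_shear (m : ∀ i, Measure (X i)) [∀ i, IsProbabilityMeasure (m i)] :
    MeasurePreserving (shear : (ι → ∀ i, X i) → ι → ∀ i, X i)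
      (Measure.pi fun _ => Measure.pi m) (Measure.pi fun _ => Measure.pi m) := by
  refine ⟨measurable_shear, ?_⟩
  symm
  refine Measure.pi_eq_generateFrom
    (C := fun _ => Set.univ.pi '' Set.univ.pi fun i => {s : Set (X i) | MeasurableSet s})
    (fun _ => generateFrom_pi) (fun _ => isPiSystem_pi)
    (fun _ => Measure.FiniteSpanningSetsIn.pi fun i => (m i).toFiniteSpanningSetsIn) ?_
  intro S hS
  choose s hs hsS using hS
  obtain rfl : (fun k => Set.univ.pi (s k)) = S := funext hsS
  have hs' : ∀ k i, MeasurableSet (s k i) := fun k i => hs k i (Set.mem_univ i)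
  have hbox : MeasurableSet (Set.univ.pi fun k => Set.univ.pi (s k)) :=
    MeasurableSet.univ_pi fun k => MeasurableSet.univ_pi (hs' k)
  rw [Measure.map_apply measurable_shear hbox]
  have : shear ⁻¹' (Set.univ.pi fun k => Set.univ.pi (s k))
      = Set.univ.pi fun k => Set.univ.pi fun i => s (k - i) i := by
    ext ω
    simp only [shear, Set.mem_preimage, Set.mem_pi, Set.mem_univ, true_implies]
    constructor
    · intro h k i; simpa using h (k - i) i
    · intro h k i; simpa using h (k + i) i
  rw [this, Measure.pi_pi]
  simp_rw [Measure.pi_pi]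
  rw [Finset.prod_comm, Finset.prod_comm (s := Finset.univ) (t := Finset.univ)
    (f := fun k i => m i (s k i))]
  refine Finset.prod_congr rfl fun i _ => ?_
  exact Equiv.prod_comp (Equiv.subRight i) (fun k => m i (s k i))

lemma measurePreserving_shear_apply {q : Measure (∀ i, X i)} [IsProbabilityMeasure q]
    {m : ∀ i, Measure (X i)} [∀ i, IsProbabilityMeasure (m i)]
    (hq : ∀ i, q.map (fun x => x i) = m i) (k : ι) :
    MeasurePreserving (fun ω : ι → ∀ i, X i => shear ω k)
      (Measure.pi fun _ : ι => q) (Measure.pi m) :=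
  measurePreserving_transversal hq (Equiv.addLeft k)

end Transversal

section

/-! ### Inequalities for the function `x log x + 1 - x` -/

/-- The graph of `klFun` lies above its tangents. -/
lemma klFun_tangent_le {x y : ℝ} (hx : 0 ≤ x) (hy : 0 < y) :
    klFun y + Real.log y * (x - y) ≤ klFun x := by
  unfold klFun
  rcases hx.eq_or_lt with rfl | hx
  · simp; nlinarith
  have h := Real.log_le_sub_one_of_pos (div_pos hy hx)
  rw [Real.log_div hy.ne' hx.ne'] at h
  have h2 := mul_le_mul_of_nonneg_left h hx.le
  have h3 : x * (y / x - 1) = y - x := by field_simp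
  nlinarith

/-- An upper bound for the second-order remainder of `klFun`. -/
lemma klFun_le_tangent_add {x y : ℝ} (hx : 0 < x) (hy : 0 ≤ y) :
    klFun y ≤ klFun x + Real.log x * (y - x) + (y - x) ^ 2 / x := by
  unfold klFun
  have h3 : (y - x) ^ 2 / x = y * (y / x - 1) - (y - x) := by field_simp
  rcases hy.eq_or_lt with rfl | hy
  · rw [h3]; simp; linarith
  have h := Real.log_le_sub_one_of_pos (div_pos hy hx)
  rw [Real.log_div hy.ne' hx.ne'] at h
  have h2 := mul_le_mul_of_nonneg_left h hy.le
  rw [h3]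
  nlinarith

/-- The remainder of `klFun` at the tangent is bounded below by a Hellinger distance. -/
lemma sq_sqrt_sub_sqrt_le_klFun {x y : ℝ} (hx : 0 ≤ x) (hy : 0 < y) :
    (√x - √y) ^ 2 ≤ klFun x - klFun y - Real.log y * (x - y) := by
  unfold klFun
  rcases hx.eq_or_lt with rfl | hx
  · simp [Real.sq_sqrt hy.le]; nlinarith
  have hsx := Real.sqrt_pos.2 hx
  have h := Real.log_le_sub_one_of_pos (div_pos (Real.sqrt_pos.2 hy) hsx)
  rw [Real.log_div (Real.sqrt_pos.2 hy).ne' hsx.ne', Real.log_sqrt hx.le,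
    Real.log_sqrt hy.le] at h
  have h2 := mul_le_mul_of_nonneg_left h hx.le
  have h3 : x * (√y / √x - 1) = √x * √y - x := by
    have : x / √x = √x := Real.div_sqrt
    rw [mul_sub, mul_div_assoc', mul_comm x, mul_div_assoc, this]; ring
  have h4 := Real.sq_sqrt hx.le
  have h5 := Real.sq_sqrt hy.le
  nlinarith

/-- A quantitative form of the convexity of `klFun`. -/
lemma klFun_midpoint_add_le {x y : ℝ} (hx : 0 ≤ x) (hy : 0 ≤ y) :
    klFun ((x + y) / 2) + (√x - √y) ^ 2 / 4 ≤ (klFun x + klFun y) / 2 := by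
  rcases (add_nonneg hx hy).eq_or_lt with h0 | h0
  · obtain rfl : x = 0 := by linarith
    obtain rfl : y = 0 := by linarith
    simp
  have h1 := sq_sqrt_sub_sqrt_le_klFun hx (half_pos h0)
  have h2 := sq_sqrt_sub_sqrt_le_klFun hy (half_pos h0)
  nlinarith [sq_nonneg (√x + √y - 2 * √((x + y) / 2))]

/-- Close to zero `klFun` has slope `-∞`. -/
lemma klFun_mul_le {ε u : ℝ} (hε : 0 < ε) (hu : 0 ≤ u) :
    klFun (ε * u) ≤ 1 + ε * (u * Real.log ε + u ^ 2) := by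
  unfold klFun
  rcases hu.eq_or_lt with rfl | hu
  · simp
  rw [Real.log_mul hε.ne' hu.ne']
  have := mul_le_mul_of_nonneg_left (Real.log_le_sub_one_of_pos hu) (mul_pos hε hu).le
  nlinarith [mul_pos hε hu]

lemma abs_sub_le_sqrt {x y t : ℝ} (hx : 0 ≤ x) (hy : 0 ≤ y) (ht : 0 < t) :
    |x - y| ≤ t * (x + y) + 1 / (2 * t) * (√x - √y) ^ 2 := by
  have h1 := Real.sq_sqrt hx
  have h2 := Real.sq_sqrt hy
  have h3 : |x - y| = |√x - √y| * (√x + √y) := by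
    rw [← abs_of_nonneg (add_nonneg (Real.sqrt_nonneg x) (Real.sqrt_nonneg y)), ← abs_mul]
    congr 1; nlinarith
  have h4 : 1 / (2 * t) * (√x - √y) ^ 2 = |√x - √y| ^ 2 / (2 * t) := by
    rw [sq_abs]; ring
  have h5 : |√x - √y| * (√x + √y) ≤ t / 2 * (√x + √y) ^ 2 + |√x - √y| ^ 2 / (2 * t) := by
    have : t / 2 * (√x + √y) ^ 2 + |√x - √y| ^ 2 / (2 * t) - |√x - √y| * (√x + √y)
      = (t * (√x + √y) - |√x - √y|) ^ 2 / (2 * t) := by field_simp; ring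
    have h := div_nonneg (sq_nonneg (t * (√x + √y) - |√x - √y|)) (mul_pos two_pos ht).le
    linarith
  have h6 : t / 2 * (√x + √y) ^ 2 ≤ t * (x + y) := by
    nlinarith [mul_nonneg ht.le (sq_nonneg (√x - √y))]
  linarith

/-! ### Densities of couplings -/

variable {D : ℕ} {Θ : Fin D → Type*} [∀ i, MeasurableSpace (Θ i)]

/-- `f` is an everywhere finite and nonnegative density, with respect to the product of the `m i`,
of a measure with marginals `m i`. -/
structure IsCouplingDensity (m : ∀ i, Measure (Θ i)) (f : (∀ i, Θ i) → ℝ) : Prop where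
  measurable : Measurable f
  nonneg : ∀ θ, 0 ≤ f θ
  marginal_eq : ∀ i, marginal ((Measure.pi m).withDensity fun θ => ENNReal.ofReal (f θ)) i = m i

/-- The objective `∫ c f + f log f dm` of entropic optimal transport, as a function of the density
`f`. The mass `1 - f`, which integrates to zero for probability densities, is added to make the
integrand nonnegative when `c` and `f` are. -/
def energy (m : ∀ i, Measure (Θ i)) (c f : (∀ i, Θ i) → ℝ) : ℝ≥0∞ :=
  ∫⁻ θ, ENNReal.ofReal (c θ * f θ + klFun (f θ)) ∂Measure.pi m

namespace IsCouplingDensity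

variable {m : ∀ i, Measure (Θ i)} {f g : (∀ i, Θ i) → ℝ}

lemma measurePreserving_eval (hf : IsCouplingDensity m f) (i : Fin D) :
    MeasurePreserving (fun θ => θ i)
      ((Measure.pi m).withDensity fun θ => ENNReal.ofReal (f θ)) (m i) :=
  ⟨measurable_pi_apply i, hf.marginal_eq i⟩

lemma setIntegral_eq (hf : IsCouplingDensity m f) (i : Fin D) {S : Set (Θ i)}
    (hS : MeasurableSet S) :
    ∫ θ in (fun θ => θ i) ⁻¹' S, f θ ∂Measure.pi m = (m i).real S := by
  rw [integral_eq_lintegral_of_nonneg_ae (ae_of_all _ hf.nonneg)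
    hf.measurable.aestronglyMeasurable, measureReal_def]
  congr 1
  conv_rhs => rw [← hf.marginal_eq i, marginal, Measure.map_apply (measurable_pi_apply i) hS,
    withDensity_apply _ (measurable_pi_apply i hS)]

lemma lintegral_comp_eval_mul (hf : IsCouplingDensity m f) (i : Fin D) {h : Θ i → ℝ≥0∞}
    (hh : Measurable h) :
    ∫⁻ θ, h (θ i) * ENNReal.ofReal (f θ) ∂Measure.pi m = ∫⁻ t, h t ∂m i := by
  have h1 := hf.marginal_eq i
  conv_rhs => rw [← h1, marginal, lintegral_map hh (measurable_pi_apply i)]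
  rw [lintegral_withDensity_eq_lintegral_mul _ hf.measurable.ennreal_ofReal
    (show Measurable fun θ : ∀ j, Θ j => h (θ i) from hh.comp (measurable_pi_apply i))]
  simp [mul_comm]

lemma integrable_comp_eval_mul (hf : IsCouplingDensity m f) {i : Fin D} {h : Θ i → ℝ}
    (hh : Integrable h (m i)) : Integrable (fun θ => h (θ i) * f θ) (Measure.pi m) := by
  have h1 := (hf.measurePreserving_eval i).integrable_comp_of_integrable hh
  rw [integrable_withDensity_iff hf.measurable.ennreal_ofReal
    (ae_of_all _ fun _ => ENNReal.ofReal_lt_top)] at h1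
  refine h1.congr (ae_of_all _ fun θ => ?_)
  simp [ENNReal.toReal_ofReal (hf.nonneg θ)]

lemma integral_comp_eval_mul (hf : IsCouplingDensity m f) {i : Fin D} {h : Θ i → ℝ}
    (hh : Integrable h (m i)) : ∫ θ, h (θ i) * f θ ∂Measure.pi m = ∫ t, h t ∂m i := by
  conv_rhs => rw [← (hf.measurePreserving_eval i).map_eq]
  rw [integral_map (measurable_pi_apply i).aemeasurable
    (by rw [(hf.measurePreserving_eval i).map_eq]; exact hh.aestronglyMeasurable),
    integral_withDensity_eq_integral_toReal_smul hf.measurable.ennreal_ofReal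
    (ae_of_all _ fun _ => ENNReal.ofReal_lt_top)]
  refine integral_congr_ae (ae_of_all _ fun θ => ?_)
  simp [ENNReal.toReal_ofReal (hf.nonneg θ), mul_comm]

variable [∀ i, IsProbabilityMeasure (m i)]

lemma lintegral_eq_one [NeZero D] (hf : IsCouplingDensity m f) :
    ∫⁻ θ, ENNReal.ofReal (f θ) ∂Measure.pi m = 1 := by
  simpa using hf.lintegral_comp_eval_mul 0 (h := fun _ => 1) measurable_const

lemma integrable [NeZero D] (hf : IsCouplingDensity m f) : Integrable f (Measure.pi m) := by
  refine ⟨hf.measurable.aestronglyMeasurable, ?_⟩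
  rw [hasFiniteIntegral_iff_ofReal (ae_of_all _ hf.nonneg), hf.lintegral_eq_one]
  exact ENNReal.one_lt_top

lemma integral_eq_one [NeZero D] (hf : IsCouplingDensity m f) :
    ∫ θ, f θ ∂Measure.pi m = 1 := by
  rw [integral_eq_lintegral_of_nonneg_ae (ae_of_all _ hf.nonneg)
    hf.measurable.aestronglyMeasurable, hf.lintegral_eq_one, ENNReal.toReal_one]

lemma isProbabilityMeasure [NeZero D] (hf : IsCouplingDensity m f) :
    IsProbabilityMeasure ((Measure.pi m).withDensity fun θ => ENNReal.ofReal (f θ)) := by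
  constructor
  rw [withDensity_apply _ MeasurableSet.univ, setLIntegral_univ, hf.lintegral_eq_one]

lemma withDensity_mem_couplings [NeZero D] (hf : IsCouplingDensity m f) :
    ((Measure.pi m).withDensity fun θ => ENNReal.ofReal (f θ)) ∈ couplings m :=
  ⟨hf.isProbabilityMeasure, hf.marginal_eq⟩

lemma of_setIntegral_eq (hm : Measurable f) (h0 : ∀ θ, 0 ≤ f θ) (hi : Integrable f (Measure.pi m))
    (h : ∀ i (S : Set (Θ i)), MeasurableSet S →
      ∫ θ in (fun θ => θ i) ⁻¹' S, f θ ∂Measure.pi m = (m i).real S) :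
    IsCouplingDensity m f := by
  refine ⟨hm, h0, fun i => ?_⟩
  ext S hS
  rw [marginal, Measure.map_apply (measurable_pi_apply i) hS,
    withDensity_apply _ (measurable_pi_apply i hS),
    ← ofReal_integral_eq_lintegral_ofReal hi.restrict (ae_of_all _ h0), h i S hS,
    ofReal_measureReal]

lemma midpoint [NeZero D] (hf : IsCouplingDensity m f) (hg : IsCouplingDensity m g) :
    IsCouplingDensity m (fun θ => (f θ + g θ) / 2) := by
  refine of_setIntegral_eq ((hf.measurable.add hg.measurable).div_const 2)
    (fun θ => by linarith [hf.nonneg θ, hg.nonneg θ])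
    ((hf.integrable.add hg.integrable).div_const 2) fun i S hS => ?_
  rw [integral_div, integral_add hf.integrable.restrict hg.integrable.restrict,
    hf.setIntegral_eq i hS, hg.setIntegral_eq i hS]
  ring

end IsCouplingDensity

lemma coupling_eq_withDensity {m : ∀ i, Measure (Θ i)} [∀ i, IsProbabilityMeasure (m i)]
    {q : Measure (∀ i, Θ i)} (hq : q ∈ couplings m) (hac : q ≪ Measure.pi m) :
    IsCouplingDensity m (fun θ => (q.rnDeriv (Measure.pi m) θ).toReal) ∧
      ((Measure.pi m).withDensity fun θ =>
        ENNReal.ofReal (q.rnDeriv (Measure.pi m) θ).toReal) = q := by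
  have := hq.1
  have h : ((Measure.pi m).withDensity fun θ =>
        ENNReal.ofReal (q.rnDeriv (Measure.pi m) θ).toReal) = q := by
    conv_rhs => rw [← Measure.withDensity_rnDeriv_eq q _ hac]
    refine withDensity_congr_ae ?_
    filter_upwards [q.rnDeriv_lt_top (Measure.pi m)] with θ hθ
    exact ENNReal.ofReal_toReal hθ.ne
  refine ⟨⟨(Measure.measurable_rnDeriv _ _).ennreal_toReal, fun _ => ENNReal.toReal_nonneg,
    fun i => ?_⟩, h⟩
  rw [h]
  exact hq.2 i

end

section

/-! ### Existence and uniqueness of the optimal density -/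

variable {D : ℕ} {Θ : Fin D → Type*} [∀ i, MeasurableSpace (Θ i)]
  {m : ∀ i, Measure (Θ i)} [∀ i, IsProbabilityMeasure (m i)] {c f g : (∀ i, Θ i) → ℝ}

omit [∀ i, IsProbabilityMeasure (m i)] in
/-- The energy is uniformly convex for the Hellinger distance. -/
lemma energy_midpoint_add_le [NeZero D] (hc : Measurable c) (hc0 : ∀ θ, 0 ≤ c θ)
    (hf : IsCouplingDensity m f) (hg : IsCouplingDensity m g) :
    energy m c (fun θ => (f θ + g θ) / 2)
      + 4⁻¹ * ∫⁻ θ, ENNReal.ofReal ((√(f θ) - √(g θ)) ^ 2) ∂Measure.pi m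
      ≤ 2⁻¹ * (energy m c f + energy m c g) := by
  have hfm := hf.measurable
  have hgm := hg.measurable
  have hk := measurable_klFun
  unfold energy
  rw [← lintegral_const_mul _ (by fun_prop), ← lintegral_add_left (by fun_prop),
    ← lintegral_add_left (by fun_prop), ← lintegral_const_mul _ (by fun_prop)]
  refine lintegral_mono fun θ => ?_
  have h0 := hf.nonneg θ
  have h1 := hg.nonneg θ
  have e4 : (4⁻¹ : ℝ≥0∞) = ENNReal.ofReal (1 / 4) := by
    rw [one_div, ENNReal.ofReal_inv_of_pos (by norm_num)]; simp
  have e2 : (2⁻¹ : ℝ≥0∞) = ENNReal.ofReal (1 / 2) := by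
    rw [one_div, ENNReal.ofReal_inv_of_pos (by norm_num)]; simp
  have h2 : 0 ≤ c θ * f θ + klFun (f θ) := add_nonneg (mul_nonneg (hc0 θ) h0) (klFun_nonneg h0)
  have h3 : 0 ≤ c θ * g θ + klFun (g θ) := add_nonneg (mul_nonneg (hc0 θ) h1) (klFun_nonneg h1)
  have h4 : 0 ≤ (f θ + g θ) / 2 := by linarith
  have h5 : 0 ≤ c θ * ((f θ + g θ) / 2) + klFun ((f θ + g θ) / 2) :=
    add_nonneg (mul_nonneg (hc0 θ) h4) (klFun_nonneg h4)
  simp only []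
  rw [e4, e2, ← ENNReal.ofReal_mul (by norm_num), ← ENNReal.ofReal_add h5 (by positivity),
    ← ENNReal.ofReal_add h2 h3, ← ENNReal.ofReal_mul (by norm_num)]
  refine ENNReal.ofReal_le_ofReal ?_
  have := klFun_midpoint_add_le h0 h1
  linarith

/-- The `L¹` distance is controlled by the Hellinger distance. -/
lemma lintegral_abs_sub_le [NeZero D] (hf : IsCouplingDensity m f) (hg : IsCouplingDensity m g)
    {t : ℝ} (ht : 0 < t) :
    ∫⁻ θ, ENNReal.ofReal |f θ - g θ| ∂Measure.pi m ≤ ENNReal.ofReal (2 * t)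
      + ENNReal.ofReal (1 / (2 * t))
        * ∫⁻ θ, ENNReal.ofReal ((√(f θ) - √(g θ)) ^ 2) ∂Measure.pi m := by
  have hfm := hf.measurable
  have hgm := hg.measurable
  have e : ENNReal.ofReal (2 * t)
      = ∫⁻ θ, ENNReal.ofReal t * (ENNReal.ofReal (f θ) + ENNReal.ofReal (g θ)) ∂Measure.pi m := by
    rw [lintegral_const_mul _ (by fun_prop), lintegral_add_left (by fun_prop),
      hf.lintegral_eq_one, hg.lintegral_eq_one, mul_comm, ENNReal.ofReal_mul ht.le,
      one_add_one_eq_two]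
    simp
  rw [e, ← lintegral_const_mul _ (by fun_prop), ← lintegral_add_left (by fun_prop)]
  refine lintegral_mono fun θ => ?_
  have h0 := hf.nonneg θ
  have h1 := hg.nonneg θ
  simp only []
  rw [← ENNReal.ofReal_add h0 h1, ← ENNReal.ofReal_mul ht.le,
    ← ENNReal.ofReal_mul (by positivity), ← ENNReal.ofReal_add (by positivity) (by positivity)]
  exact ENNReal.ofReal_le_ofReal (abs_sub_le_sqrt h0 h1 ht)

/-- `f` minimizes the energy among the densities of couplings, with finite value. -/
structure IsOptimalDensity (m : ∀ i, Measure (Θ i)) (c f : (∀ i, Θ i) → ℝ) : Prop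
    extends IsCouplingDensity m f where
  energy_ne_top : energy m c f ≠ ⊤
  energy_le : ∀ g, IsCouplingDensity m g → energy m c f ≤ energy m c g

/-- If `f` and `g` have energy at most `δ` above a lower bound for the energy of all couplings,
then they are close to each other. -/
lemma lintegral_sq_sqrt_sub_le [NeZero D] (hc : Measurable c) (hc0 : ∀ θ, 0 ≤ c θ)
    (hf : IsCouplingDensity m f) (hg : IsCouplingDensity m g) {I δ : ℝ≥0∞} (hI : I ≠ ⊤)
    (hlow : ∀ g, IsCouplingDensity m g → I ≤ energy m c g)
    (hfI : energy m c f ≤ I + δ) (hgI : energy m c g ≤ I + δ) :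
    ∫⁻ θ, ENNReal.ofReal ((√(f θ) - √(g θ)) ^ 2) ∂Measure.pi m ≤ 4 * δ := by
  have h := (energy_midpoint_add_le hc hc0 hf hg).trans
    (mul_le_mul_right (add_le_add hfI hgI) 2⁻¹)
  rw [← two_mul, ← mul_assoc, ENNReal.inv_mul_cancel two_ne_zero ENNReal.ofNat_ne_top,
    one_mul] at h
  have h2 := (add_le_add_left (hlow _ (hf.midpoint hg)) _).trans h
  rw [ENNReal.add_le_add_iff_left hI] at h2
  calc _ = 4 * (4⁻¹ * ∫⁻ θ, ENNReal.ofReal ((√(f θ) - √(g θ)) ^ 2) ∂Measure.pi m) := by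
        rw [← mul_assoc, ENNReal.mul_inv_cancel (by norm_num) ENNReal.ofNat_ne_top, one_mul]
    _ ≤ 4 * δ := mul_le_mul_right h2 4

/-- Two optimal densities agree almost everywhere. -/
lemma IsOptimalDensity.ae_eq [NeZero D] (hc : Measurable c) (hc0 : ∀ θ, 0 ≤ c θ)
    (hf : IsOptimalDensity m c f) (hg : IsOptimalDensity m c g) : f =ᵐ[Measure.pi m] g := by
  have hfm := hf.measurable
  have hgm := hg.measurable
  have h := lintegral_sq_sqrt_sub_le (δ := 0) hc hc0 hf.toIsCouplingDensity
    hg.toIsCouplingDensity hf.energy_ne_top hf.energy_le (by simp)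
    (by simpa using hg.energy_le _ hf.toIsCouplingDensity)
  rw [mul_zero, nonpos_iff_eq_zero, lintegral_eq_zero_iff (by fun_prop)] at h
  filter_upwards [h] with θ hθ
  have h1 : (√(f θ) - √(g θ)) ^ 2 = 0 :=
    le_antisymm (ENNReal.ofReal_eq_zero.1 hθ) (sq_nonneg _)
  rw [← Real.sqrt_inj (hf.nonneg θ) (hg.nonneg θ)]
  exact sub_eq_zero.1 (pow_eq_zero_iff two_ne_zero |>.1 h1)

open Filter Topology in
/-- A minimizing sequence of densities converges in `L¹`, and its limit is optimal by Fatou's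
lemma. -/
lemma exists_isOptimalDensity [NeZero D] (hc : Measurable c) (hc0 : ∀ θ, 0 ≤ c θ)
    (hg : IsCouplingDensity m g) (hgfin : energy m c g ≠ ⊤) :
    ∃ f, IsOptimalDensity m c f := by
  set I : ℝ≥0∞ := ⨅ (f) (_ : IsCouplingDensity m f), energy m c f with hI
  have hlow : ∀ f, IsCouplingDensity m f → I ≤ energy m c f := fun f hf => iInf₂_le f hf
  have hItop : I ≠ ⊤ := ne_top_of_le_ne_top hgfin (hlow g hg)
  have hex : ∀ n : ℕ, ∃ f, IsCouplingDensity m f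
      ∧ energy m c f ≤ I + ENNReal.ofReal (((1 / 2 : ℝ) ^ n) ^ 2) := by
    intro n
    have : I < I + ENNReal.ofReal (((1 / 2 : ℝ) ^ n) ^ 2) :=
      ENNReal.lt_add_right hItop (by simp)
    simp only [hI, iInf_lt_iff] at this
    obtain ⟨f, hf, hlt⟩ := this
    exact ⟨f, hf, hlt.le⟩
  choose F hF hFI using hex
  have hmem : ∀ n, MemLp (F n) 1 (Measure.pi m) := fun n =>
    memLp_one_iff_integrable.2 (hF n).integrable
  have hsum : (∑' n : ℕ, ENNReal.ofReal (5 * (1 / 2 : ℝ) ^ n)) ≠ ⊤ := by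
    rw [← ENNReal.ofReal_tsum_of_nonneg (fun n => by positivity)
      (summable_geometric_two.mul_left 5)]
    exact ENNReal.ofReal_ne_top
  obtain ⟨fl, hfl, hlim⟩ := Lp.cauchy_complete_eLpNorm le_rfl hmem hsum (by
    intro N n k hn hk
    have hle : ∀ j, N ≤ j → energy m c (F j) ≤ I + ENNReal.ofReal (((1 / 2 : ℝ) ^ N) ^ 2) := by
      intro j hj
      refine (hFI j).trans (add_le_add_right (ENNReal.ofReal_le_ofReal ?_) _)
      have := pow_le_pow_of_le_one (by norm_num : (0 : ℝ) ≤ 1 / 2) (by norm_num) hj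
      gcongr
    have h1 := lintegral_sq_sqrt_sub_le hc hc0 (hF n) (hF k) hItop hlow (hle n hn) (hle k hk)
    have hp : (0 : ℝ) < (1 / 2 : ℝ) ^ N := by positivity
    have h2 := (lintegral_abs_sub_le (hF n) (hF k) hp).trans
      (add_le_add_right (mul_le_mul_right h1 _) _)
    have e4 : (4 : ℝ≥0∞) = ENNReal.ofReal 4 := by simp
    rw [e4, ← ENNReal.ofReal_mul (by norm_num), ← ENNReal.ofReal_mul (by positivity),
      ← ENNReal.ofReal_add (by positivity) (by positivity)] at h2
    rw [eLpNorm_one_eq_lintegral_enorm]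
    simp only [Pi.sub_apply, ← ofReal_norm, Real.norm_eq_abs]
    refine h2.trans_lt ((ENNReal.ofReal_lt_ofReal_iff (by positivity)).2 ?_)
    have : 1 / (2 * (1 / 2 : ℝ) ^ N) * (4 * ((1 / 2 : ℝ) ^ N) ^ 2) = 2 * (1 / 2 : ℝ) ^ N := by
      field_simp; norm_num
    rw [this]
    linarith)
  obtain ⟨ns, hns, hae⟩ := (tendstoInMeasure_of_tendsto_eLpNorm one_ne_zero
    (fun n => (hmem n).1) hfl.1 hlim).exists_seq_tendsto_ae
  -- an everywhere nonnegative measurable version of the limit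
  set f : (∀ i, Θ i) → ℝ := fun θ => max (hfl.1.mk fl θ) 0 with hfdef
  have hfm : Measurable f := hfl.1.stronglyMeasurable_mk.measurable.max measurable_const
  have hffl : f =ᵐ[Measure.pi m] fl := by
    filter_upwards [hae, hfl.1.ae_eq_mk] with θ hθ hmk
    have : 0 ≤ fl θ := ge_of_tendsto' hθ fun n => (hF (ns n)).nonneg θ
    simp only [hfdef, ← hmk, max_eq_left this]
  have hfc : IsCouplingDensity m f := by
    refine IsCouplingDensity.of_setIntegral_eq hfm (fun θ => le_max_right _ _)
      ((memLp_one_iff_integrable.1 hfl).congr hffl.symm) fun i S hS => ?_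
    rw [integral_congr_ae (ae_restrict_of_ae hffl)]
    have h1 := tendsto_setIntegral_of_L1' fl hfl.1
      (Eventually.of_forall fun n => (hF n).integrable) hlim ((fun θ => θ i) ⁻¹' S)
    refine tendsto_nhds_unique h1 (tendsto_const_nhds.congr fun n => ?_)
    exact ((hF n).setIntegral_eq i hS).symm
  have hle : energy m c f ≤ I := by
    have hcont : ∀ᵐ θ ∂Measure.pi m, ENNReal.ofReal (c θ * f θ + klFun (f θ))
        = liminf (fun n => ENNReal.ofReal (c θ * F (ns n) θ + klFun (F (ns n) θ))) atTop := by
      filter_upwards [hae, hffl] with θ hθ hfθ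
      rw [hfθ]
      refine (Tendsto.liminf_eq ?_).symm
      refine (ENNReal.continuous_ofReal.tendsto _).comp ?_
      exact (hθ.const_mul (c θ)).add ((continuous_klFun.tendsto _).comp hθ)
    have hk := measurable_klFun
    unfold energy
    rw [lintegral_congr_ae hcont]
    refine (lintegral_liminf_le fun n => ?_).trans ?_
    · have := (hF (ns n)).measurable
      fun_prop
    · have hT : Tendsto (fun n => I + ENNReal.ofReal (((1 / 2 : ℝ) ^ ns n) ^ 2)) atTop (𝓝 I) := by
        have h0 : Tendsto (fun n : ℕ => ((1 / 2 : ℝ) ^ n) ^ 2) atTop (𝓝 0) := by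
          have := (tendsto_pow_atTop_nhds_zero_of_lt_one
            (by norm_num : (0 : ℝ) ≤ 1 / 2) (by norm_num)).pow 2
          simpa using this
        have h1 := (ENNReal.continuous_ofReal.tendsto _).comp (h0.comp hns.tendsto_atTop)
        have := h1.const_add I
        simpa using this
      rw [← hT.liminf_eq]
      exact liminf_le_liminf (Eventually.of_forall fun n => hFI (ns n))
  exact ⟨f, hfc, ne_top_of_le_ne_top hItop hle, fun g hg => hle.trans (hlow g hg)⟩

end

section

/-! ### First variation of the energy under an exchange of coordinates -/

/-- The law of `φ ω`, for `ω` restricted to a set `G` that `φ` maps into `B`, has a density bounded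
by one and supported in `B`, with respect to the law of `φ ω` without the restriction. -/
lemma exists_density_map_restrict {Ω E : Type*} [MeasurableSpace Ω] [MeasurableSpace E]
    {P : Measure Ω} [IsFiniteMeasure P] {μ : Measure E} [IsFiniteMeasure μ] {φ : Ω → E}
    (hφ : MeasurePreserving φ P μ)
    {G : Set Ω} {B : Set E} (hB : MeasurableSet B) (hGB : ∀ ω ∈ G, φ ω ∈ B)
    (hG : MeasurableSet G) :
    ∃ u : E → ℝ, Measurable u ∧ (∀ x, 0 ≤ u x) ∧ (∀ x, u x ≤ 1) ∧ (∀ x ∉ B, u x = 0) ∧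
      ∀ h : E → ℝ, Measurable h → ∫ x, h x * u x ∂μ = ∫ ω in G, h (φ ω) ∂P := by
  set ν := (P.restrict G).map φ with hν
  have hle : ν ≤ μ := by
    rw [hν, ← hφ.map_eq]
    exact Measure.map_mono Measure.restrict_le_self hφ.measurable
  have hνB : ν.restrict B = ν := by
    refine Measure.restrict_eq_self_of_ae_mem ?_
    rw [hν]
    refine (ae_map_iff hφ.measurable.aemeasurable hB).2 ?_
    exact (ae_restrict_iff' hG).2 (ae_of_all _ hGB)
  have hd := Measure.measurable_rnDeriv ν μ
  have hum : Measurable (B.indicator fun x => min (ν.rnDeriv μ x).toReal 1) :=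
    (hd.ennreal_toReal.min measurable_const).indicator hB
  have h0 : ∀ x, 0 ≤ B.indicator (fun x => min (ν.rnDeriv μ x).toReal 1) x := fun x =>
    Set.indicator_nonneg (fun _ _ => le_min ENNReal.toReal_nonneg zero_le_one) x
  refine ⟨B.indicator fun x => min (ν.rnDeriv μ x).toReal 1, hum, h0,
    fun x => Set.indicator_le' (fun _ _ => min_le_right _ _) (fun _ _ => zero_le_one) x,
    fun x hx => Set.indicator_of_notMem hx _, fun h hh => ?_⟩
  have hwd : μ.withDensity (fun x => ENNReal.ofReal
      (B.indicator (fun x => min (ν.rnDeriv μ x).toReal 1) x)) = ν := by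
    conv_rhs => rw [← hνB, ← Measure.withDensity_rnDeriv_eq ν μ hle.absolutelyContinuous,
      restrict_withDensity hB, ← withDensity_indicator hB]
    refine withDensity_congr_ae ?_
    filter_upwards [Measure.rnDeriv_le_one_of_le hle] with x hx
    by_cases hxB : x ∈ B
    · rw [Set.indicator_of_mem hxB, Set.indicator_of_mem hxB, min_eq_left,
        ENNReal.ofReal_toReal (ne_top_of_le_ne_top ENNReal.one_ne_top hx)]
      exact ENNReal.toReal_le_of_le_ofReal zero_le_one (by simpa using hx)
    · rw [Set.indicator_of_notMem hxB, Set.indicator_of_notMem hxB, ENNReal.ofReal_zero]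
  generalize (B.indicator fun x => min (ν.rnDeriv μ x).toReal 1) = u at hum h0 hwd ⊢
  rw [← integral_map (μ := P.restrict G) (f := h) hφ.measurable.aemeasurable
    hh.aestronglyMeasurable, ← hν, ← hwd,
    integral_withDensity_eq_integral_toReal_smul hum.ennreal_ofReal
      (ae_of_all _ fun _ => ENNReal.ofReal_lt_top)]
  refine integral_congr_ae (ae_of_all _ fun x => ?_)
  simp only [ENNReal.toReal_ofReal (h0 x), smul_eq_mul, mul_comm]

variable {D : ℕ} {Θ : Fin D → Type*} [∀ i, MeasurableSpace (Θ i)]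
  {m : ∀ i, Measure (Θ i)}

/-- The densities `v` and `u` of the points lost and gained when the samples `ω k`, for `ω` in `G`,
exchange their coordinates. -/
lemma exists_exchange [∀ i, IsProbabilityMeasure (m i)] [NeZero D] {G : Set (Fin D → ∀ i, Θ i)}
    (hG : MeasurableSet G)
    {B B' : Set (∀ i, Θ i)} (hB : MeasurableSet B) (hB' : MeasurableSet B')
    (hGB : ∀ ω ∈ G, ∀ k, shear ω k ∈ B) (hGB' : ∀ ω ∈ G, ∀ k, ω k ∈ B') :
    ∃ u v : (∀ i, Θ i) → ℝ, Measurable u ∧ Measurable v ∧ (∀ θ, 0 ≤ u θ) ∧ (∀ θ, 0 ≤ v θ) ∧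
      (∀ θ, u θ ≤ D) ∧ (∀ θ, v θ ≤ D) ∧ (∀ θ ∉ B, u θ = 0) ∧ (∀ θ ∉ B', v θ = 0) ∧
      ∀ h : (∀ i, Θ i) → ℝ, Measurable h → (∃ K, ∀ θ, |h θ| ≤ K) →
        ∫ θ, h θ * u θ ∂Measure.pi m
            = ∫ ω in G, ∑ k, h (shear ω k) ∂Measure.pi (fun _ => Measure.pi m) ∧
        ∫ θ, h θ * v θ ∂Measure.pi m
            = ∫ ω in G, ∑ k, h (ω k) ∂Measure.pi (fun _ => Measure.pi m) := by
  have sumlem : ∀ (φ : Fin D → (Fin D → ∀ i, Θ i) → ∀ i, Θ i)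
      (_ : ∀ k, MeasurePreserving (φ k) (Measure.pi fun _ => Measure.pi m) (Measure.pi m))
      {C : Set (∀ i, Θ i)} (_ : MeasurableSet C) (_ : ∀ ω ∈ G, ∀ k, φ k ω ∈ C),
      ∃ u : (∀ i, Θ i) → ℝ, Measurable u ∧ (∀ θ, 0 ≤ u θ) ∧ (∀ θ, u θ ≤ D) ∧
        (∀ θ ∉ C, u θ = 0) ∧ ∀ h : (∀ i, Θ i) → ℝ, Measurable h → (∃ K, ∀ θ, |h θ| ≤ K) →
        ∫ θ, h θ * u θ ∂Measure.pi m
            = ∫ ω in G, ∑ k, h (φ k ω) ∂Measure.pi (fun _ => Measure.pi m) := by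
    intro φ hφ C hC hGC
    choose u hum hu0 hu1 huC hu using fun k =>
      exists_density_map_restrict (hφ k) hC (fun ω hω => hGC ω hω k) hG
    refine ⟨fun θ => ∑ k, u k θ, by fun_prop, fun θ => Finset.sum_nonneg fun k _ => hu0 k θ,
      fun θ => (Finset.sum_le_sum fun k _ => hu1 k θ).trans (by simp),
      fun θ hθ => Finset.sum_eq_zero fun k _ => huC k θ hθ, ?_⟩
    rintro h hh ⟨K, hK⟩
    simp_rw [Finset.mul_sum]
    rw [integral_finsetSum, integral_finsetSum]
    · exact Finset.sum_congr rfl fun k _ => hu k h hh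
    · intro k _
      exact (Integrable.of_bound (hh.comp (hφ k).measurable).aestronglyMeasurable K
        (ae_of_all _ fun ω => hK _))
    · intro k _
      refine Integrable.of_bound (hh.mul (hum k)).aestronglyMeasurable (K * 1)
        (ae_of_all _ fun θ => ?_)
      rw [norm_mul]
      refine mul_le_mul (hK θ) ?_ (norm_nonneg _) ((abs_nonneg _).trans (hK θ))
      rw [Real.norm_of_nonneg (hu0 k θ)]
      exact hu1 k θ
  obtain ⟨u, hum, hu0, huD, huB, hu⟩ := sumlem (fun k ω => shear ω k)
    (fun k => measurePreserving_shear_apply (map_pi_eval m) k) hB hGB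
  obtain ⟨v, hvm, hv0, hvD, hvB, hv⟩ := sumlem (fun k ω => ω k)
    (fun k => ⟨measurable_pi_apply k, map_pi_eval _ k⟩) hB' hGB'
  exact ⟨u, v, hum, hvm, hu0, hv0, huD, hvD, huB, hvB, fun h hh hK => ⟨hu h hh hK, hv h hh hK⟩⟩

/-- A direction `u - v` in which the density `f` of a coupling can be varied: `u` and `v` have the
same marginals, `v` is dominated by `f`, and both live where `c` and `f` are bounded. -/
structure IsAdmissibleDirection (m : ∀ i, Measure (Θ i)) (c f : (∀ i, Θ i) → ℝ) (N C : ℝ)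
    (u v : (∀ i, Θ i) → ℝ) : Prop where
  measurable_fst : Measurable u
  measurable_snd : Measurable v
  nonneg_fst : ∀ θ, 0 ≤ u θ
  nonneg_snd : ∀ θ, 0 ≤ v θ
  fst_le : ∀ θ, u θ ≤ C
  snd_le : ∀ θ, v θ ≤ C
  snd_le_mul : ∀ θ, v θ ≤ C * f θ
  fst_eq_zero : ∀ θ, ¬ (c θ ≤ N ∧ f θ ≤ N) → u θ = 0
  snd_eq_zero : ∀ θ, ¬ (c θ ≤ N ∧ f θ ≤ N) → v θ = 0
  setIntegral_eq : ∀ i (S : Set (Θ i)), MeasurableSet S →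
    ∫ θ in (fun θ => θ i) ⁻¹' S, u θ ∂Measure.pi m = ∫ θ in (fun θ => θ i) ⁻¹' S, v θ ∂Measure.pi m

lemma klFun_le_one_add_sq {x : ℝ} (hx : 0 ≤ x) : klFun x ≤ 1 + x ^ 2 := by
  simpa using klFun_mul_le one_pos hx

/-- The first order condition at an optimal density, for finite increments. -/
lemma IsOptimalDensity.integral_variation_nonneg [∀ i, IsProbabilityMeasure (m i)] [NeZero D]
    {c f u v : (∀ i, Θ i) → ℝ} {N C ε : ℝ}
    (hc : Measurable c) (hc0 : ∀ θ, 0 ≤ c θ) (hf : IsOptimalDensity m c f)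
    (huv : IsAdmissibleDirection m c f N C u v) (hε0 : 0 < ε) (hε1 : ε ≤ 1) (hεC : ε * C ≤ 1) :
    Integrable (fun θ => c θ * (ε * (u θ - v θ)) + klFun (f θ + ε * (u θ - v θ)) - klFun (f θ))
      (Measure.pi m) ∧
    0 ≤ ∫ θ, (c θ * (ε * (u θ - v θ)) + klFun (f θ + ε * (u θ - v θ)) - klFun (f θ))
      ∂Measure.pi m := by
  have hk := measurable_klFun
  have hfm := hf.measurable
  have hum := huv.measurable_fst
  have hvm := huv.measurable_snd
  have hg0 : ∀ θ, 0 ≤ f θ + ε * (u θ - v θ) := fun θ => by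
    have h1 := mul_le_mul_of_nonneg_left (huv.snd_le_mul θ) hε0.le
    have h2 := mul_le_mul_of_nonneg_right hεC (hf.nonneg θ)
    have h3 := mul_nonneg hε0.le (huv.nonneg_fst θ)
    nlinarith
  have hui : Integrable u (Measure.pi m) := Integrable.of_bound hum.aestronglyMeasurable C
    (ae_of_all _ fun θ => by rw [Real.norm_of_nonneg (huv.nonneg_fst θ)]; exact huv.fst_le θ)
  have hvi : Integrable v (Measure.pi m) := Integrable.of_bound hvm.aestronglyMeasurable C
    (ae_of_all _ fun θ => by rw [Real.norm_of_nonneg (huv.nonneg_snd θ)]; exact huv.snd_le θ)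
  have hd : Integrable (fun θ => ε * (u θ - v θ)) (Measure.pi m) := (hui.sub hvi).const_mul ε
  have hgc : IsCouplingDensity m (fun θ => f θ + ε * (u θ - v θ)) := by
    refine IsCouplingDensity.of_setIntegral_eq (by fun_prop) hg0
      (hf.integrable.add hd) fun i S hS => ?_
    rw [integral_add hf.integrable.restrict hd.restrict,
      integral_const_mul, integral_sub hui.restrict hvi.restrict, huv.setIntegral_eq i S hS,
      hf.setIntegral_eq i hS]
    ring
  have hvar : Integrable (fun θ => c θ * (ε * (u θ - v θ)) + klFun (f θ + ε * (u θ - v θ))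
      - klFun (f θ)) (Measure.pi m) := by
    refine Integrable.of_bound (by fun_prop) (|N| * |C| + (1 + (|N| + |C|) ^ 2) + (1 + |N| ^ 2))
      (ae_of_all _ fun θ => ?_)
    by_cases hθ : c θ ≤ N ∧ f θ ≤ N
    · have h1 : |ε * (u θ - v θ)| ≤ |C| := by
        rw [abs_mul, abs_of_pos hε0]
        refine (mul_le_of_le_one_left (abs_nonneg _) hε1).trans ?_
        rw [abs_le]
        have := le_abs_self C
        constructor <;> linarith [huv.nonneg_fst θ, huv.nonneg_snd θ, huv.fst_le θ, huv.snd_le θ]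
      have h2 : |c θ * (ε * (u θ - v θ))| ≤ |N| * |C| := by
        rw [abs_mul, abs_of_nonneg (hc0 θ)]
        exact mul_le_mul (hθ.1.trans (le_abs_self N)) h1 (abs_nonneg _) (abs_nonneg _)
      have h3 : klFun (f θ + ε * (u θ - v θ)) ≤ 1 + (|N| + |C|) ^ 2 := by
        refine (klFun_le_one_add_sq (hg0 θ)).trans ?_
        have := hg0 θ
        gcongr
        · exact hθ.2.trans (le_abs_self N)
        · exact (le_abs_self _).trans h1
      have h4 : klFun (f θ) ≤ 1 + |N| ^ 2 := by
        refine (klFun_le_one_add_sq (hf.nonneg θ)).trans ?_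
        have := hf.nonneg θ
        gcongr
        exact hθ.2.trans (le_abs_self N)
      have h5 := klFun_nonneg (hg0 θ)
      have h6 := klFun_nonneg (hf.nonneg θ)
      rw [abs_le] at h2
      rw [Real.norm_eq_abs, abs_le]
      constructor <;> linarith
    · rw [huv.fst_eq_zero θ hθ, huv.snd_eq_zero θ hθ]
      simp
      positivity
  refine ⟨hvar, ?_⟩
  have he0 : ∀ θ, 0 ≤ c θ * f θ + klFun (f θ) := fun θ =>
    add_nonneg (mul_nonneg (hc0 θ) (hf.nonneg θ)) (klFun_nonneg (hf.nonneg θ))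
  have he0' : ∀ θ, 0 ≤ c θ * (f θ + ε * (u θ - v θ)) + klFun (f θ + ε * (u θ - v θ)) := fun θ =>
    add_nonneg (mul_nonneg (hc0 θ) (hg0 θ)) (klFun_nonneg (hg0 θ))
  have hei : Integrable (fun θ => c θ * f θ + klFun (f θ)) (Measure.pi m) := by
    refine ⟨by fun_prop, ?_⟩
    rw [hasFiniteIntegral_iff_ofReal (ae_of_all _ he0)]
    exact hf.energy_ne_top.lt_top
  have hei' : Integrable (fun θ => c θ * (f θ + ε * (u θ - v θ)) + klFun (f θ + ε * (u θ - v θ)))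
      (Measure.pi m) := by
    refine (hei.add hvar).congr (ae_of_all _ fun θ => ?_)
    simp only [Pi.add_apply]
    ring
  have hle := hf.energy_le _ hgc
  unfold energy at hle
  rw [← ofReal_integral_eq_lintegral_ofReal hei (ae_of_all _ he0),
    ← ofReal_integral_eq_lintegral_ofReal hei' (ae_of_all _ he0'),
    ENNReal.ofReal_le_ofReal_iff (integral_nonneg he0'), ← sub_nonneg,
    ← integral_sub hei' hei] at hle
  refine hle.trans_eq (integral_congr_ae (ae_of_all _ fun θ => ?_))
  simp only []
  ring

end

section

/-! ### Positivity and additive structure of the optimal density -/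

variable {D : ℕ} {Θ : Fin D → Type*} [∀ i, MeasurableSpace (Θ i)]
  {m : ∀ i, Measure (Θ i)} [∀ i, IsProbabilityMeasure (m i)] {c f : (∀ i, Θ i) → ℝ}

/-- A function whose sublevel sets are the regions where `c` and `f` are bounded and `f`, unless it
vanishes, is bounded away from zero. -/
def spread (c f : (∀ i, Θ i) → ℝ) (θ : ∀ i, Θ i) : ℝ := c θ + f θ + (f θ)⁻¹

/-- The total of `spread` over all the points of an exchange, before and after. -/
def totalSpread (c f : (∀ i, Θ i) → ℝ) [NeZero D] (ω : Fin D → ∀ i, Θ i) : ℝ :=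
  ∑ k, (spread c f (ω k) + spread c f (shear ω k))

omit [∀ i, MeasurableSpace (Θ i)] in
lemma spread_nonneg (hc0 : ∀ θ, 0 ≤ c θ) (hf0 : ∀ θ, 0 ≤ f θ) (θ : ∀ i, Θ i) :
    0 ≤ spread c f θ :=
  add_nonneg (add_nonneg (hc0 θ) (hf0 θ)) (inv_nonneg.2 (hf0 θ))

lemma measurable_spread (hc : Measurable c) (hf : Measurable f) : Measurable (spread c f) :=
  (hc.add hf).add hf.inv

lemma measurable_totalSpread [NeZero D] (hc : Measurable c) (hf : Measurable f) :
    Measurable (totalSpread c f) := by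
  have h := measurable_spread hc hf
  refine Finset.measurable_sum _ fun k _ => ?_
  exact (h.comp (measurable_pi_apply k)).add
    (h.comp ((measurable_pi_apply k).comp measurable_shear))

omit [∀ i, MeasurableSpace (Θ i)] in
lemma spread_le_totalSpread [NeZero D] (hc0 : ∀ θ, 0 ≤ c θ) (hf0 : ∀ θ, 0 ≤ f θ)
    (ω : Fin D → ∀ i, Θ i) (k : Fin D) :
    spread c f (ω k) ≤ totalSpread c f ω ∧ spread c f (shear ω k) ≤ totalSpread c f ω := by
  have h := spread_nonneg hc0 hf0
  have h1 := Finset.single_le_sum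
    (f := fun k => spread c f (ω k) + spread c f (shear ω k))
    (fun k _ => add_nonneg (h _) (h _)) (Finset.mem_univ k)
  constructor
  · exact (le_add_of_nonneg_right (h _)).trans h1
  · exact (le_add_of_nonneg_left (h _)).trans h1

/-- Samples with bounded total spread, at which `f` is positive, can be exchanged. -/
lemma exists_isAdmissibleDirection [NeZero D] (hc : Measurable c) (hc0 : ∀ θ, 0 ≤ c θ)
    (hf : Measurable f) (hf0 : ∀ θ, 0 ≤ f θ) {G : Set (Fin D → ∀ i, Θ i)} (hG : MeasurableSet G)
    {N : ℝ} (hN : 0 ≤ N) (hGN : ∀ ω ∈ G, totalSpread c f ω ≤ N)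
    (hGf : ∀ ω ∈ G, ∀ k, 0 < f (ω k)) {B : Set (∀ i, Θ i)} (hB : MeasurableSet B)
    (hGB : ∀ ω ∈ G, ∀ k, shear ω k ∈ B) :
    ∃ u v, IsAdmissibleDirection m c f N (D * (N + 1)) u v ∧
      (∀ θ, ¬ (spread c f θ ≤ N ∧ θ ∈ B) → u θ = 0) ∧
      (∀ θ, ¬ (spread c f θ ≤ N ∧ 0 < f θ) → v θ = 0) ∧
      ∀ h : (∀ i, Θ i) → ℝ, Measurable h → (∃ K, ∀ θ, |h θ| ≤ K) →
        ∫ θ, h θ * u θ ∂Measure.pi m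
            = ∫ ω in G, ∑ k, h (shear ω k) ∂Measure.pi (fun _ => Measure.pi m) ∧
        ∫ θ, h θ * v θ ∂Measure.pi m
            = ∫ ω in G, ∑ k, h (ω k) ∂Measure.pi (fun _ => Measure.pi m) := by
  have hsm := measurable_spread hc hf
  have hwN : MeasurableSet {θ | spread c f θ ≤ N} := measurableSet_le hsm measurable_const
  obtain ⟨u, v, hum, hvm, hu0, hv0, huD, hvD, huB, hvB, huv⟩ := exists_exchange (m := m) hG
    (B := {θ | spread c f θ ≤ N} ∩ B) (B' := {θ | spread c f θ ≤ N} ∩ {θ | 0 < f θ})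
    (hwN.inter hB) (hwN.inter (measurableSet_lt measurable_const hf))
    (fun ω hω k => ⟨(spread_le_totalSpread hc0 hf0 ω k).2.trans (hGN ω hω), hGB ω hω k⟩)
    (fun ω hω k => ⟨(spread_le_totalSpread hc0 hf0 ω k).1.trans (hGN ω hω), hGf ω hω k⟩)
  have hD : (D : ℝ) ≤ D * (N + 1) := le_mul_of_one_le_right (Nat.cast_nonneg D) (by linarith)
  have hgood : ∀ θ, spread c f θ ≤ N → c θ ≤ N ∧ f θ ≤ N := fun θ hθ => by
    have h1 := hc0 θ
    have h2 := hf0 θ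
    have h3 := inv_nonneg.2 h2
    unfold spread at hθ
    constructor <;> linarith
  refine ⟨u, v, ⟨hum, hvm, hu0, hv0, fun θ => (huD θ).trans hD, fun θ => (hvD θ).trans hD,
    fun θ => ?_, fun θ hθ => huB θ fun h => hθ (hgood θ h.1),
    fun θ hθ => hvB θ fun h => hθ (hgood θ h.1), fun i S hS => ?_⟩, huB, hvB, huv⟩
  · by_cases hθ : spread c f θ ≤ N ∧ 0 < f θ
    · have h1 : (f θ)⁻¹ ≤ N := by
        have h1 := hc0 θ
        have h2 := hf0 θ
        have := hθ.1
        unfold spread at this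
        linarith
      have h2 : 1 ≤ (N + 1) * f θ := by
        have := mul_le_mul_of_nonneg_right h1 hθ.2.le
        rw [inv_mul_cancel₀ hθ.2.ne'] at this
        linarith [hθ.2]
      calc v θ ≤ D * 1 := by simpa using hvD θ
        _ ≤ D * ((N + 1) * f θ) := mul_le_mul_of_nonneg_left h2 (Nat.cast_nonneg D)
        _ = _ := by ring
    · rw [hvB θ hθ]
      exact mul_nonneg (mul_nonneg (Nat.cast_nonneg D) (by linarith)) (hf0 θ)
  · have hS' : MeasurableSet ((fun θ : ∀ i, Θ i => θ i) ⁻¹' S) := measurable_pi_apply i hS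
    set h : (∀ i, Θ i) → ℝ := ((fun θ : ∀ i, Θ i => θ i) ⁻¹' S).indicator 1 with hh
    have hhm : Measurable h := measurable_one.indicator hS'
    have hmul : ∀ g : (∀ i, Θ i) → ℝ,
        ((fun θ : ∀ i, Θ i => θ i) ⁻¹' S).indicator g = fun θ => h θ * g θ := by
      intro g
      ext θ
      by_cases hθ : θ ∈ (fun θ : ∀ i, Θ i => θ i) ⁻¹' S <;> simp [hh, hθ]
    obtain ⟨h1, h2⟩ := huv h hhm ⟨1, fun θ => by
      by_cases hθ : θ ∈ (fun θ : ∀ i, Θ i => θ i) ⁻¹' S <;> simp [hh, hθ]⟩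
    rw [← integral_indicator hS', ← integral_indicator hS', hmul, hmul, h1, h2]
    congr 1
    ext ω
    -- the samples and the exchanged points have the same `i`-th coordinates, permuted
    exact Equiv.sum_comp (Equiv.addRight i)
      (fun k => (S.indicator (1 : Θ i → ℝ)) (ω k i))

/-- The optimal density is positive almost everywhere: otherwise an exchange of coordinates would
move mass into its zero set, where the entropy has slope `-∞`. -/
lemma IsOptimalDensity.ae_pos [NeZero D] (hc : Measurable c) (hc0 : ∀ θ, 0 ≤ c θ)
    (hf : IsOptimalDensity m c f) : ∀ᵐ θ ∂Measure.pi m, 0 < f θ := by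
  have hfm := hf.measurable
  have hf0 := hf.nonneg
  set P := Measure.pi (fun _ : Fin D => Measure.pi m) with hP
  set A : Set (∀ i, Θ i) := {θ | f θ = 0} with hA
  have hAm : MeasurableSet A := measurableSet_eq_fun hfm measurable_const
  have hbm := measurable_totalSpread hc hfm
  have hpm : ∀ k, Measurable fun ω : Fin D → ∀ i, Θ i => f (ω k) := fun k => by fun_prop
  have hsm : Measurable fun ω : Fin D → ∀ i, Θ i => f (shear ω 0) :=
    hfm.comp ((measurable_pi_apply 0).comp measurable_shear)
  set G : ℕ → Set (Fin D → ∀ i, Θ i) := fun n =>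
    {ω | (∀ k, 0 < f (ω k)) ∧ f (shear ω 0) = 0 ∧ totalSpread c f ω ≤ n} with hGdef
  have hall : MeasurableSet {ω : Fin D → ∀ i, Θ i | ∀ k, 0 < f (ω k)} := by
    convert MeasurableSet.iInter fun k =>
      measurableSet_lt (measurable_const (a := (0 : ℝ))) (hpm k)
    ext ω
    simp
  have hGm : ∀ n, MeasurableSet (G n) := fun n => hall.inter
      ((measurableSet_eq_fun hsm measurable_const).inter
        (measurableSet_le hbm measurable_const))
  have hnull : ∀ n, P (G n) = 0 := by
    intro n
    by_contra hne
    obtain ⟨u, v, huv, -, -, hint⟩ := exists_isAdmissibleDirection (m := m) hc hc0 hfm hf0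
      (hGm n) (Nat.cast_nonneg n) (fun ω hω => hω.2.2) (fun ω hω => hω.1) MeasurableSet.univ
      (fun _ _ _ => Set.mem_univ _)
    have hD1 : (1 : ℝ) ≤ D := by exact_mod_cast NeZero.one_le
    set N : ℝ := (n : ℝ) with hN
    have hN0 : 0 ≤ N := Nat.cast_nonneg n
    set C : ℝ := D * (N + 1) with hC
    have hC1 : 1 ≤ C := by nlinarith
    set h : (∀ i, Θ i) → ℝ := A.indicator 1 with hh
    have hhm : Measurable h := measurable_one.indicator hAm
    have hh01 : ∀ θ, 0 ≤ h θ ∧ h θ ≤ 1 := fun θ => by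
      by_cases hθ : θ ∈ A <;> simp [hh, hθ]
    have hhK : ∃ K, ∀ θ, |h θ| ≤ K := ⟨1, fun θ => by
      rw [abs_of_nonneg (hh01 θ).1]; exact (hh01 θ).2⟩
    set I : ℝ := ∫ θ, h θ * u θ ∂Measure.pi m with hI
    -- the mass that the exchange puts on the zero set
    have hIpos : 0 < I := by
      have h1 : P.real (G n) ≤ I := by
        rw [hI, (hint h hhm hhK).1]
        have h2 : P.real (G n) = ∫ ω in G n, (1 : ℝ) ∂P := by simp
        rw [h2]
        refine setIntegral_mono_on (by simp) ?_ (hGm n) fun ω hω => ?_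
        · refine (Integrable.of_bound (C := D) ?_ (ae_of_all _ fun ω => ?_))
          · refine (Finset.measurable_sum _ fun k _ => ?_).aestronglyMeasurable
            exact hhm.comp ((measurable_pi_apply k).comp measurable_shear)
          · rw [Real.norm_of_nonneg (Finset.sum_nonneg fun k _ => (hh01 _).1)]
            exact (Finset.sum_le_sum fun k _ => (hh01 _).2).trans (by simp)
        · have h3 : h (shear ω 0) = 1 := Set.indicator_of_mem (show _ ∈ A from hω.2.1) _
          rw [← h3]
          exact Finset.single_le_sum (f := fun k => h (shear ω k))
            (fun k _ => (hh01 _).1) (Finset.mem_univ 0)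
      refine lt_of_lt_of_le ?_ h1
      exact ENNReal.toReal_pos hne (measure_ne_top _ _)
    set K : ℝ := N * C + C * (N + C) + 2 * C with hK
    have hK0 : 0 ≤ K := by positivity
    have key : ∀ ε, 0 < ε → 2 * (ε * C) ≤ 1 → 0 ≤ K + Real.log ε * I := by
      intro ε hε hεC
      have hε1 : ε ≤ 1 := by nlinarith
      obtain ⟨hvi, hv⟩ := hf.integral_variation_nonneg hc hc0 huv hε hε1 (by nlinarith)
      have hhu : Integrable (fun θ => h θ * u θ) (Measure.pi m) := by
        refine Integrable.of_bound (hhm.mul huv.measurable_fst).aestronglyMeasurable (1 * C)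
          (ae_of_all _ fun θ => ?_)
        rw [norm_mul, Real.norm_of_nonneg (hh01 θ).1, Real.norm_of_nonneg (huv.nonneg_fst θ)]
        exact mul_le_mul (hh01 θ).2 (huv.fst_le θ) (huv.nonneg_fst θ) zero_le_one
      have hpt : ∀ θ, c θ * (ε * (u θ - v θ)) + klFun (f θ + ε * (u θ - v θ)) - klFun (f θ)
          ≤ ε * (K + Real.log ε * (h θ * u θ)) := by
        intro θ
        have hu0 := huv.nonneg_fst θ
        have hv0 := huv.nonneg_snd θ
        have huC := huv.fst_le θ
        by_cases hθ : c θ ≤ N ∧ f θ ≤ N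
        swap
        · rw [huv.fst_eq_zero θ hθ, huv.snd_eq_zero θ hθ]
          simp only [mul_zero, add_zero, zero_add, sub_self]
          positivity
        have h1 : c θ * (ε * (u θ - v θ)) ≤ ε * (N * C) := by
          have e1 : c θ * u θ ≤ N * C := mul_le_mul hθ.1 huC hu0 hN0
          have e2 := mul_nonneg (hc0 θ) hv0
          have e3 := mul_le_mul_of_nonneg_left e1 hε.le
          have e4 := mul_nonneg hε.le e2
          linarith
        rcases (hf0 θ).eq_or_lt with hfθ | hfθ
        · have hvz : v θ = 0 := by
            have := huv.snd_le_mul θ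
            rw [← hfθ, mul_zero] at this
            exact le_antisymm this hv0
          have hh1 : h θ = 1 := Set.indicator_of_mem (show _ ∈ A from hfθ.symm) _
          have h2 := klFun_mul_le hε hu0
          have h3 : u θ ^ 2 ≤ C * (N + C) := by nlinarith
          have h4 := mul_le_mul_of_nonneg_left h3 hε.le
          rw [hvz] at h1
          rw [← hfθ, hvz, zero_add, sub_zero, klFun_zero, hh1, hK]
          rw [sub_zero] at h1
          nlinarith [mul_pos hε (lt_of_lt_of_le one_pos hC1)]
        · have hh0 : h θ = 0 := Set.indicator_of_notMem (show θ ∉ A from hfθ.ne') _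
          set y := f θ + ε * (u θ - v θ) with hy
          have hy1 : f θ / 2 ≤ y := by
            have e1 := mul_le_mul_of_nonneg_left (huv.snd_le_mul θ) hε.le
            have e2 := mul_le_mul_of_nonneg_right hεC hfθ.le
            have e3 := mul_nonneg hε.le hu0
            nlinarith
          have hypos : 0 < y := lt_of_lt_of_le (half_pos hfθ) hy1
          have hyN : y ≤ N + C := by
            have e1 := mul_le_mul_of_nonneg_right hε1 hu0
            have e2 := mul_nonneg hε.le hv0
            nlinarith [hθ.2]
          have h2 := klFun_tangent_le (hf0 θ) hypos
          have h3 : u θ * Real.log y ≤ C * (N + C) := by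
            have e1 : Real.log y ≤ N + C := by
              linarith [Real.log_le_sub_one_of_pos hypos]
            calc u θ * Real.log y ≤ u θ * (N + C) := mul_le_mul_of_nonneg_left e1 hu0
              _ ≤ C * (N + C) := mul_le_mul_of_nonneg_right huC (by linarith)
          have h4 : - (v θ * Real.log y) ≤ 2 * C := by
            have e1 : - Real.log y ≤ y⁻¹ := by
              have := Real.log_le_sub_one_of_pos (inv_pos.2 hypos)
              rw [Real.log_inv] at this
              linarith
            have e2 : v θ ≤ 2 * C * y := by nlinarith [huv.snd_le_mul θ]
            calc - (v θ * Real.log y) = v θ * (- Real.log y) := by ring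
              _ ≤ v θ * y⁻¹ := mul_le_mul_of_nonneg_left e1 hv0
              _ ≤ 2 * C * y * y⁻¹ := mul_le_mul_of_nonneg_right e2 (inv_nonneg.2 hypos.le)
              _ = 2 * C := by field_simp
          have h5 : klFun y - klFun (f θ) ≤ ε * (C * (N + C) + 2 * C) := by
            have e1 : Real.log y * (f θ - y) = - (ε * (u θ * Real.log y - v θ * Real.log y)) := by
              rw [hy]; ring
            have e2 : u θ * Real.log y - v θ * Real.log y ≤ C * (N + C) + 2 * C := by linarith
            have e3 := mul_le_mul_of_nonneg_left e2 hε.le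
            linarith
          rw [hh0, hK]
          linarith
      have h6 := hv.trans (integral_mono hvi
        (((integrable_const K).add (hhu.const_mul (Real.log ε))).const_mul ε) hpt)
      rw [integral_const_mul] at h6
      simp only [Pi.add_apply] at h6
      rw [integral_add (integrable_const K) (hhu.const_mul (Real.log ε)), integral_const_mul] at h6
      simp only [integral_const, probReal_univ, one_smul] at h6
      exact nonneg_of_mul_nonneg_right h6 hε
    have h7 := key (Real.exp (-(max (Real.log (2 * C)) ((K + 1) / I)))) (Real.exp_pos _) (by
      have e1 : Real.exp (-(max (Real.log (2 * C)) ((K + 1) / I))) ≤ (2 * C)⁻¹ := by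
        rw [← Real.exp_log (show 0 < (2 * C)⁻¹ by positivity), Real.log_inv]
        exact Real.exp_le_exp.2 (neg_le_neg (le_max_left _ _))
      calc _ ≤ 2 * ((2 * C)⁻¹ * C) := by gcongr
        _ = 1 := by field_simp)
    rw [Real.log_exp] at h7
    have h8 : K + 1 ≤ max (Real.log (2 * C)) ((K + 1) / I) * I :=
      (div_le_iff₀ hIpos).1 (le_max_right _ _)
    linarith
  have hP0 : P {ω | (∀ k, 0 < f (ω k)) ∧ f (shear ω 0) = 0} = 0 := by
    refine measure_mono_null (fun ω hω => ?_) (measure_iUnion_null hnull)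
    obtain ⟨n, hn⟩ := exists_nat_ge (totalSpread c f ω)
    exact Set.mem_iUnion.2 ⟨n, hω.1, hω.2, hn⟩
  -- independent samples of the optimal coupling itself
  set q := (Measure.pi m).withDensity fun θ => ENNReal.ofReal (f θ) with hq
  have : IsProbabilityMeasure q := hf.isProbabilityMeasure
  have hqac : q ≪ Measure.pi m := withDensity_absolutelyContinuous _ _
  have hQ0 : ∀ᵐ ω ∂Measure.pi (fun _ : Fin D => q),
      ¬ ((∀ k, 0 < f (ω k)) ∧ f (shear ω 0) = 0) := by
    have h1 := pi_absolutelyContinuous (fun _ : Fin D => Measure.pi m) (fun _ => hqac) hP0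
    simpa [ae_iff] using h1
  have hQpos : ∀ᵐ ω ∂Measure.pi (fun _ : Fin D => q), ∀ k, 0 < f (ω k) := by
    refine ae_all_iff.2 fun k => ?_
    have h1 : ∀ᵐ θ ∂q, 0 < f θ := by
      rw [hq, ae_withDensity_iff hfm.ennreal_ofReal]
      exact ae_of_all _ fun θ hθ => by simpa using hθ
    exact (Measure.quasiMeasurePreserving_eval (fun _ : Fin D => q) k).ae h1
  have hmp := measurePreserving_shear_apply (q := q) hf.marginal_eq 0
  have h9 : ∀ᵐ ω ∂Measure.pi (fun _ : Fin D => q), 0 < f (shear ω 0) := by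
    filter_upwards [hQ0, hQpos] with ω h1 h2
    exact lt_of_le_of_ne (hf0 _) fun h => h1 ⟨h2, h.symm⟩
  rw [← hmp.map_eq]
  exact (ae_map_iff hmp.measurable.aemeasurable (measurableSet_lt measurable_const hfm)).2 h9

end

section

variable {D : ℕ} {Θ : Fin D → Type*} [∀ i, MeasurableSpace (Θ i)]
  {m : ∀ i, Measure (Θ i)} [∀ i, IsProbabilityMeasure (m i)] {c f : (∀ i, Θ i) → ℝ}

/-- The first order condition: exchanging coordinates between samples does not decrease the total
of the first variation `Z = log f + c` of the energy. -/
lemma IsOptimalDensity.ae_sum_le_sum_shear [NeZero D] (hc : Measurable c) (hc0 : ∀ θ, 0 ≤ c θ)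
    (hf : IsOptimalDensity m c f) :
    ∀ᵐ ω ∂Measure.pi (fun _ : Fin D => Measure.pi m),
      ∑ k, (Real.log (f (ω k)) + c (ω k))
        ≤ ∑ k, (Real.log (f (shear ω k)) + c (shear ω k)) := by
  have hfm := hf.measurable
  have hf0 := hf.nonneg
  have hk := measurable_klFun
  set P := Measure.pi (fun _ : Fin D => Measure.pi m) with hP
  set Z : (∀ i, Θ i) → ℝ := fun θ => Real.log (f θ) + c θ with hZ
  have hZm : Measurable Z := by fun_prop
  have hFm : Measurable fun ω : Fin D → ∀ i, Θ i => ∑ k, Z (ω k) := by fun_prop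
  have hFTm : Measurable fun ω : Fin D → ∀ i, Θ i => ∑ k, Z (shear ω k) :=
    hFm.comp measurable_shear
  have hbm := measurable_totalSpread hc hfm
  have hall : MeasurableSet {ω : Fin D → ∀ i, Θ i | ∀ k, 0 < f (ω k)} := by
    convert MeasurableSet.iInter fun k =>
      measurableSet_lt (measurable_const (a := (0 : ℝ)))
        (show Measurable fun ω : Fin D → ∀ i, Θ i => f (ω k) by fun_prop)
    ext ω
    simp
  set G : ℕ → Set (Fin D → ∀ i, Θ i) := fun n =>
    {ω | (∀ k, 0 < f (ω k)) ∧ (∀ k, 0 < f (shear ω k)) ∧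
      ∑ k, Z (shear ω k) < ∑ k, Z (ω k) ∧ totalSpread c f ω ≤ n} with hGdef
  have hGm : ∀ n, MeasurableSet (G n) := fun n =>
    hall.inter ((measurable_shear hall).inter ((measurableSet_lt hFTm hFm).inter
      (measurableSet_le hbm measurable_const)))
  have hnull : ∀ n, P (G n) = 0 := by
    intro n
    have hBm : MeasurableSet {θ | 0 < f θ} := measurableSet_lt measurable_const hfm
    obtain ⟨u, v, huv, huB, hvB, hint⟩ := exists_isAdmissibleDirection (m := m) hc hc0 hfm hf0
      (hGm n) (Nat.cast_nonneg n) (fun ω hω => hω.2.2.2) (fun ω hω => hω.1) hBm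
      (fun ω hω k => hω.2.1 k)
    set N : ℝ := (n : ℝ) with hN
    have hN0 : 0 ≤ N := Nat.cast_nonneg n
    have hD1 : (1 : ℝ) ≤ D := by exact_mod_cast NeZero.one_le
    set C : ℝ := D * (N + 1) with hC
    have hC1 : 1 ≤ C := by nlinarith
    set B : Set (∀ i, Θ i) := {θ | spread c f θ ≤ N} ∩ {θ | 0 < f θ} with hB
    have hBmeas : MeasurableSet B :=
      (measurableSet_le (measurable_spread hc hfm) measurable_const).inter hBm
    set h : (∀ i, Θ i) → ℝ := B.indicator Z with hh
    have hhm : Measurable h := hZm.indicator hBmeas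
    have hhN : ∀ θ, |h θ| ≤ N := by
      intro θ
      by_cases hθ : θ ∈ B
      · rw [hh, Set.indicator_of_mem hθ]
        have h1 : c θ + f θ + (f θ)⁻¹ ≤ N := hθ.1
        have h2 := Real.log_le_sub_one_of_pos hθ.2
        have h3 := Real.log_le_sub_one_of_pos (inv_pos.2 hθ.2)
        rw [Real.log_inv] at h3
        have h4 := hc0 θ
        have h5 := hf0 θ
        have h6 := inv_nonneg.2 h5
        rw [hZ, abs_le]
        constructor <;> linarith
      · rw [hh, Set.indicator_of_notMem hθ]
        simpa using hN0
    obtain ⟨hiu, hiv⟩ := hint h hhm ⟨N, hhN⟩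
    have hbdd : ∀ g : (∀ i, Θ i) → ℝ, Measurable g → (∀ θ, 0 ≤ g θ) → (∀ θ, g θ ≤ C) →
        Integrable (fun θ => h θ * g θ) (Measure.pi m) := by
      intro g hg hg0 hgC
      refine Integrable.of_bound (hhm.mul hg).aestronglyMeasurable (N * C)
        (ae_of_all _ fun θ => ?_)
      rw [norm_mul, Real.norm_of_nonneg (hg0 θ)]
      exact mul_le_mul (hhN θ) (hgC θ) (hg0 θ) hN0
    have hhu := hbdd u huv.measurable_fst huv.nonneg_fst huv.fst_le
    have hhv := hbdd v huv.measurable_snd huv.nonneg_snd huv.snd_le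
    have hhd : Integrable (fun θ => h θ * u θ - h θ * v θ) (Measure.pi m) := hhu.sub hhv
    have key : ∀ ε, 0 < ε → ε * C ≤ 1 →
        0 ≤ (∫ θ, h θ * u θ ∂Measure.pi m - ∫ θ, h θ * v θ ∂Measure.pi m) + ε * (C ^ 2 * N) := by
      intro ε hε hεC
      have hε1 : ε ≤ 1 := by nlinarith
      obtain ⟨hvi, hv⟩ := hf.integral_variation_nonneg hc hc0 huv hε hε1 hεC
      have hpt : ∀ θ, c θ * (ε * (u θ - v θ)) + klFun (f θ + ε * (u θ - v θ)) - klFun (f θ)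
          ≤ ε * ((h θ * u θ - h θ * v θ) + ε * (C ^ 2 * N)) := by
        intro θ
        by_cases hθ : θ ∈ B
        swap
        · rw [huB θ hθ, hvB θ hθ]
          simp only [mul_zero, add_zero, zero_add, sub_self]
          positivity
        have hu0 := huv.nonneg_fst θ
        have hv0 := huv.nonneg_snd θ
        have huC := huv.fst_le θ
        have hvC := huv.snd_le θ
        have hy : 0 ≤ f θ + ε * (u θ - v θ) := by
          have h1 := mul_le_mul_of_nonneg_left (huv.snd_le_mul θ) hε.le
          have h2 := mul_le_mul_of_nonneg_right hεC (hf0 θ)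
          have h3 := mul_nonneg hε.le hu0
          nlinarith
        have h1 := klFun_le_tangent_add hθ.2 hy
        have h2 : h θ = Real.log (f θ) + c θ := Set.indicator_of_mem hθ _
        have h3 : (f θ)⁻¹ ≤ N := by
          have : c θ + f θ + (f θ)⁻¹ ≤ N := hθ.1
          linarith [hc0 θ, hf0 θ]
        have h4 : (u θ - v θ) ^ 2 ≤ C ^ 2 := sq_le_sq' (by linarith) (by linarith)
        have h5 : (f θ + ε * (u θ - v θ) - f θ) ^ 2 / f θ ≤ ε ^ 2 * (C ^ 2 * N) := by
          calc _ = ε ^ 2 * ((u θ - v θ) ^ 2 * (f θ)⁻¹) := by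
                rw [div_eq_mul_inv]; ring
            _ ≤ _ := by
                refine mul_le_mul_of_nonneg_left ?_ (sq_nonneg ε)
                exact mul_le_mul h4 h3 (inv_nonneg.2 (hf0 θ)) (sq_nonneg C)
        rw [h2]
        nlinarith
      have h6 := hv.trans (integral_mono hvi
        ((hhd.add (integrable_const (ε * (C ^ 2 * N)))).const_mul ε) hpt)
      rw [integral_const_mul] at h6
      simp only [Pi.add_apply] at h6
      rw [integral_add hhd (integrable_const _), integral_sub hhu hhv] at h6
      simp only [integral_const, probReal_univ, one_smul] at h6
      exact nonneg_of_mul_nonneg_right h6 hε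
    have hge : 0 ≤ ∫ θ, h θ * u θ ∂Measure.pi m - ∫ θ, h θ * v θ ∂Measure.pi m := by
      refine le_of_forall_pos_le_add fun δ hδ => ?_
      have hE : 0 < C ^ 2 * N + C + 1 := by positivity
      set ε := min (1 / C) (δ / (C ^ 2 * N + C + 1)) with hε
      have hεpos : 0 < ε := lt_min (by positivity) (by positivity)
      have h1 := key ε hεpos (by
        calc ε * C ≤ 1 / C * C := mul_le_mul_of_nonneg_right (min_le_left _ _) (by linarith)
          _ = 1 := by field_simp)
      have h2 : ε * (C ^ 2 * N) ≤ δ := by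
        calc ε * (C ^ 2 * N) ≤ ε * (C ^ 2 * N + C + 1) := by
              refine mul_le_mul_of_nonneg_left (by linarith) hεpos.le
          _ ≤ δ / (C ^ 2 * N + C + 1) * (C ^ 2 * N + C + 1) :=
              mul_le_mul_of_nonneg_right (min_le_right _ _) hE.le
          _ = δ := by field_simp
      linarith
    have hshift : ∀ φ : (Fin D → ∀ i, Θ i) → Fin D → ∀ i, Θ i, Measurable φ →
        Integrable (fun ω => ∑ k, h (φ ω k)) (P.restrict (G n)) := by
      intro φ hφ
      refine integrable_finsetSum _ fun k _ => ?_
      exact Integrable.of_bound (hhm.comp ((measurable_pi_apply k).comp hφ)).aestronglyMeasurable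
        N (ae_of_all _ fun ω => hhN _)
    have hi1 := hshift (fun ω => ω) measurable_id
    have hi2 := hshift shear measurable_shear
    rw [hiu, hiv, ← integral_sub hi2 hi1, ← neg_nonpos, ← integral_neg] at hge
    have hneg : ∀ ω ∈ G n, 0 < -(∑ k, h (shear ω k) - ∑ k, h (ω k)) := by
      intro ω hω
      have h1 : ∀ k, h (ω k) = Z (ω k) := fun k => Set.indicator_of_mem
        (show ω k ∈ B from
          ⟨(spread_le_totalSpread hc0 hf0 ω k).1.trans hω.2.2.2, hω.1 k⟩) _
      have h2 : ∀ k, h (shear ω k) = Z (shear ω k) := fun k => Set.indicator_of_mem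
        (show shear ω k ∈ B from
          ⟨(spread_le_totalSpread hc0 hf0 ω k).2.trans hω.2.2.2, hω.2.1 k⟩) _
      simp only [h1, h2]
      linarith [hω.2.2.1]
    have hnn : 0 ≤ᵐ[P.restrict (G n)] fun ω => -(∑ k, h (shear ω k) - ∑ k, h (ω k)) :=
      (ae_restrict_iff' (hGm n)).2 (ae_of_all _ fun ω hω => (hneg ω hω).le)
    have hz := (integral_eq_zero_iff_of_nonneg_ae hnn (hi2.sub hi1).neg).1
      (le_antisymm hge (integral_nonneg_of_ae hnn))
    have hz' := (ae_restrict_iff' (hGm n)).1 hz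
    rw [ae_iff] at hz'
    refine measure_mono_null (fun ω hω => ?_) hz'
    exact fun h => (hneg ω hω).ne' (h hω)
  have hpos := hf.ae_pos hc hc0
  have hpos1 : ∀ᵐ ω ∂P, ∀ k, 0 < f (ω k) := ae_all_iff.2 fun k =>
    (Measure.quasiMeasurePreserving_eval (fun _ : Fin D => Measure.pi m) k).ae hpos
  have hpos2 : ∀ᵐ ω ∂P, ∀ k, 0 < f (shear ω k) :=
    (measurePreserving_shear m).quasiMeasurePreserving.ae hpos1
  have hun : ∀ᵐ ω ∂P, ω ∉ ⋃ n, G n :=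
    measure_eq_zero_iff_ae_notMem.1 (measure_iUnion_null hnull)
  filter_upwards [hpos1, hpos2, hun] with ω h1 h2 h3
  by_contra h4
  obtain ⟨n, hn⟩ := exists_nat_ge (totalSpread c f ω)
  exact h3 (Set.mem_iUnion.2 ⟨n, h1, h2, not_le.1 h4, hn⟩)

/-- A measure preserving transformation of a finite measure cannot increase a function almost
everywhere without preserving it. -/
lemma ae_eq_comp_of_le {Ω : Type*} [MeasurableSpace Ω] {P : Measure Ω} [IsFiniteMeasure P]
    {T : Ω → Ω} (hT : MeasurePreserving T P P) {F : Ω → ℝ} (hF : Measurable F)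
    (h : ∀ᵐ ω ∂P, F ω ≤ F (T ω)) : ∀ᵐ ω ∂P, F ω = F (T ω) := by
  have hg : Measurable fun ω => Real.arctan (F ω) := Real.measurable_arctan.comp hF
  have hgi : Integrable (fun ω => Real.arctan (F ω)) P := by
    refine Integrable.of_bound hg.aestronglyMeasurable (Real.pi / 2) (ae_of_all _ fun ω => ?_)
    rw [Real.norm_eq_abs, abs_le]
    exact ⟨(Real.neg_pi_div_two_lt_arctan _).le, (Real.arctan_lt_pi_div_two _).le⟩
  have hgT : Integrable (fun ω => Real.arctan (F (T ω))) P :=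
    hT.integrable_comp_of_integrable hgi
  have hint : ∫ ω, Real.arctan (F (T ω)) ∂P = ∫ ω, Real.arctan (F ω) ∂P := by
    conv_rhs => rw [← hT.map_eq]
    rw [integral_map hT.measurable.aemeasurable (by
      rw [hT.map_eq]; exact hg.aestronglyMeasurable)]
  have hle : (fun ω => Real.arctan (F ω)) ≤ᵐ[P] fun ω => Real.arctan (F (T ω)) := by
    filter_upwards [h] with ω hω using Real.arctan_strictMono.monotone hω
  filter_upwards [(integral_eq_iff_of_ae_le hgi hgT hle).1 hint.symm] with ω hω
  exact Real.arctan_injective hω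

/-- Resampling, for each `k`, the `k`-th coordinate of the `k`-th sample. -/
lemma measurePreserving_update_diagonal (m : ∀ i, Measure (Θ i)) [∀ i, IsProbabilityMeasure (m i)] :
    MeasurePreserving
      (fun (p : (Fin D → ∀ i, Θ i) × (∀ i, Θ i)) (k : Fin D) => Function.update (p.1 k) k (p.2 k))
      ((Measure.pi fun _ : Fin D => Measure.pi m).prod (Measure.pi m))
      (Measure.pi fun _ : Fin D => Measure.pi m) := by
  have hm : Measurable (fun (p : (Fin D → ∀ i, Θ i) × (∀ i, Θ i)) (k : Fin D) =>
      Function.update (p.1 k) k (p.2 k)) := by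
    refine measurable_pi_iff.2 fun k => ?_
    exact (measurePreserving_update m k).measurable.comp
      (show Measurable fun p : (Fin D → ∀ i, Θ i) × (∀ i, Θ i) => (p.1 k, p.2 k) by fun_prop)
  refine ⟨hm, ?_⟩
  symm
  refine Measure.pi_eq_generateFrom
    (C := fun _ => Set.univ.pi '' Set.univ.pi fun i => {s : Set (Θ i) | MeasurableSet s})
    (fun _ => generateFrom_pi) (fun _ => isPiSystem_pi)
    (fun _ => Measure.FiniteSpanningSetsIn.pi fun i => (m i).toFiniteSpanningSetsIn) ?_
  intro S hS
  choose s hs hsS using hS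
  obtain rfl : (fun k => Set.univ.pi (s k)) = S := funext hsS
  have hs' : ∀ k i, MeasurableSet (s k i) := fun k i => hs k i (Set.mem_univ i)
  have hbox : MeasurableSet (Set.univ.pi fun k => Set.univ.pi (s k)) :=
    MeasurableSet.univ_pi fun k => MeasurableSet.univ_pi (hs' k)
  rw [Measure.map_apply hm hbox]
  have : (fun (p : (Fin D → ∀ i, Θ i) × (∀ i, Θ i)) (k : Fin D) =>
        Function.update (p.1 k) k (p.2 k)) ⁻¹' (Set.univ.pi fun k => Set.univ.pi (s k))
      = (Set.univ.pi fun k => Set.univ.pi (Function.update (s k) k Set.univ)) ×ˢ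
        (Set.univ.pi fun k => s k k) := by
    ext p
    simp only [Set.mem_preimage, Set.mem_pi, Set.mem_univ, true_implies, Set.mem_prod]
    constructor
    · intro h
      refine ⟨fun k i => ?_, fun k => by simpa using h k k⟩
      by_cases hi : i = k
      · subst hi; simp
      · simpa [Function.update_of_ne hi] using h k i
    · rintro ⟨h, h'⟩ k i
      by_cases hi : i = k
      · subst hi; simpa using h' i
      · simpa [Function.update_of_ne hi] using h k i
  rw [this, Measure.prod_prod, Measure.pi_pi, Measure.pi_pi, ← Finset.prod_mul_distrib]
  refine Finset.prod_congr rfl fun k _ => ?_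
  rw [Measure.pi_pi, Measure.pi_pi, ← Finset.prod_erase_mul _ _ (Finset.mem_univ k),
    ← Finset.prod_erase_mul (a := k) Finset.univ (fun i => m i (s k i)) (Finset.mem_univ k)]
  congr 1
  rw [Function.update_self, measure_univ, mul_one]
  refine Finset.prod_congr rfl fun i hi => ?_
  rw [Function.update_of_ne (Finset.ne_of_mem_erase hi)]

/-- A function whose total over `D` samples is invariant under the exchange of coordinates is a sum
of functions of single coordinates. The point `shear ω 0` collects the coordinates `ω i i`, each of
which enters only one of the other terms; freezing all other coordinates gives the splitting. -/
lemma exists_ae_eq_sum_of_shear_invariant [NeZero D] {Z : (∀ i, Θ i) → ℝ} (hZ : Measurable Z)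
    (h : ∀ᵐ ω ∂Measure.pi (fun _ : Fin D => Measure.pi m),
      ∑ k, Z (ω k) = ∑ k, Z (shear ω k)) :
    ∃ φ : ∀ i, Θ i → ℝ, (∀ i, Measurable (φ i)) ∧
      ∀ᵐ θ ∂Measure.pi m, Z θ = ∑ i, φ i (θ i) := by
  have h1 := Measure.ae_ae_of_ae_prod
    ((measurePreserving_update_diagonal m).quasiMeasurePreserving.ae h)
  obtain ⟨ω, hω⟩ := h1.exists
  set K : ℝ := ∑ k ∈ Finset.univ.erase (0 : Fin D), Z (shear ω k) with hK
  refine ⟨fun k t => Z (Function.update (ω k) k t) - (if k = 0 then K else 0), fun k => ?_, ?_⟩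
  · exact (hZ.comp (measurable_update _)).sub_const _
  · filter_upwards [hω] with θ hθ
    rw [← Finset.add_sum_erase _ (fun k => Z (shear _ k)) (Finset.mem_univ (0 : Fin D))] at hθ
    have h2 : shear (fun k => Function.update (ω k) k (θ k)) 0 = θ := by
      ext i
      simp only [shear]
      rw [zero_add, Function.update_self]
    have h3 : ∀ k ∈ Finset.univ.erase (0 : Fin D),
        Z (shear (fun k => Function.update (ω k) k (θ k)) k) = Z (shear ω k) := by
      intro k hk
      congr 1
      ext i
      have : i ≠ k + i := fun h => Finset.ne_of_mem_erase hk (by simpa using h)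
      simp [shear, Function.update_of_ne this]
    rw [h2, Finset.sum_congr rfl h3] at hθ
    rw [Finset.sum_sub_distrib]
    simp only [Finset.sum_ite_eq', Finset.mem_univ, if_true]
    linarith

/-- The Schrödinger equations: the optimal density is `exp (∑ i, φ i - c)`. -/
lemma IsOptimalDensity.exists_potentials [NeZero D] (hc : Measurable c) (hc0 : ∀ θ, 0 ≤ c θ)
    (hf : IsOptimalDensity m c f) :
    ∃ φ : ∀ i, Θ i → ℝ, (∀ i, Measurable (φ i)) ∧
      ∀ᵐ θ ∂Measure.pi m, f θ = Real.exp (∑ i, φ i (θ i) - c θ) := by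
  have hfm := hf.measurable
  have hZm : Measurable fun θ => Real.log (f θ) + c θ := by fun_prop
  have h1 := ae_eq_comp_of_le (measurePreserving_shear m)
    (F := fun ω => ∑ k, (Real.log (f (ω k)) + c (ω k)))
    (Finset.measurable_sum _ fun k _ => hZm.comp (measurable_pi_apply k))
    (hf.ae_sum_le_sum_shear hc hc0)
  obtain ⟨φ, hφm, hφ⟩ := exists_ae_eq_sum_of_shear_invariant hZm h1
  refine ⟨φ, hφm, ?_⟩
  filter_upwards [hφ, hf.ae_pos hc hc0] with θ h2 h3
  rw [← h2, add_sub_cancel_right, Real.exp_log h3]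

end

section

variable {D : ℕ} {Θ : Fin D → Type*} [∀ i, MeasurableSpace (Θ i)]
  {m : ∀ i, Measure (Θ i)} [∀ i, IsProbabilityMeasure (m i)] {c f g : (∀ i, Θ i) → ℝ}

/-! ### Uniqueness, measurability and boundedness of potentials -/

/-- Sums of functions of single coordinates determine their summands up to constants; the summands
need not be measurable. -/
lemma exists_const_of_sum_eq_zero {d : ∀ i, Θ i → ℝ}
    (h : ∀ᵐ θ ∂Measure.pi m, ∑ i, d i (θ i) = 0) :
    ∃ k : Fin D → ℝ, ∑ i, k i = 0 ∧ ∀ i, ∀ᵐ t ∂m i, d i t = k i := by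
  have h1 : ∀ᵐ θ ∂Measure.pi m, ∀ i, ∀ᵐ t ∂m i,
      ∑ j, d j (Function.update θ i t j) = 0 := ae_all_iff.2 fun i =>
    Measure.ae_ae_of_ae_prod ((measurePreserving_update m i).quasiMeasurePreserving.ae h)
  obtain ⟨θ, h0, hθ⟩ := (h.and h1).exists
  refine ⟨fun i => d i (θ i), h0, fun i => ?_⟩
  filter_upwards [hθ i] with t ht
  rw [← Finset.add_sum_erase _ _ (Finset.mem_univ i)] at ht h0
  rw [Finset.sum_congr rfl (fun j hj => by
    rw [Function.update_of_ne (Finset.ne_of_mem_erase hj)]), Function.update_self] at ht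
  linarith

/-- If a sum of functions of single coordinates is almost everywhere equal to a measurable
function, then the summands have measurable versions. -/
lemma exists_measurable_of_sum_eq {φ : ∀ i, Θ i → ℝ} {Z : (∀ i, Θ i) → ℝ} (hZ : Measurable Z)
    (h : ∀ᵐ θ ∂Measure.pi m, ∑ i, φ i (θ i) = Z θ) :
    ∃ ψ : ∀ i, Θ i → ℝ, (∀ i, Measurable (ψ i)) ∧ ∀ i, φ i =ᵐ[m i] ψ i := by
  have h1 : ∀ i, ∃ ψ : Θ i → ℝ, Measurable ψ ∧ φ i =ᵐ[m i] ψ := by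
    intro i
    obtain ⟨θ, hθ⟩ := (Measure.ae_ae_of_ae_prod
      ((measurePreserving_update m i).quasiMeasurePreserving.ae h)).exists
    refine ⟨fun t => Z (Function.update θ i t) - ∑ j ∈ Finset.univ.erase i, φ j (θ j),
      (hZ.comp (measurable_update θ)).sub_const _, ?_⟩
    filter_upwards [hθ] with t ht
    rw [← Finset.add_sum_erase _ _ (Finset.mem_univ i)] at ht
    rw [Finset.sum_congr rfl (fun j hj => by
      rw [Function.update_of_ne (Finset.ne_of_mem_erase hj)]), Function.update_self] at ht
    linarith
  choose ψ hψ hφψ using h1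
  exact ⟨ψ, hψ, hφψ⟩

/-- Conditionally on one coordinate, the density of a coupling integrates to one. -/
lemma IsCouplingDensity.ae_lintegral_update_eq_one (hf : IsCouplingDensity m f) (i : Fin D) :
    ∀ᵐ t ∂m i, ∫⁻ θ, ENNReal.ofReal (f (Function.update θ i t)) ∂Measure.pi m = 1 := by
  have hmp := (measurePreserving_update m i).comp
    (Measure.measurePreserving_swap (μ := m i) (ν := Measure.pi m))
  have hfm := hf.measurable
  have hm : Measurable fun p : Θ i × (∀ j, Θ j) =>
      ENNReal.ofReal (f (Function.update p.2 i p.1)) :=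
    hfm.ennreal_ofReal.comp hmp.measurable
  refine ae_eq_of_forall_setLIntegral_eq_of_sigmaFinite hm.lintegral_prod_right'
    measurable_const fun S hS _ => ?_
  have h1 : Measurable (S.indicator (1 : Θ i → ℝ≥0∞)) := measurable_one.indicator hS
  have h2 := hf.lintegral_comp_eval_mul i h1
  rw [lintegral_indicator_one hS] at h2
  rw [setLIntegral_const, one_mul, ← h2, ← lintegral_indicator hS,
    ← hmp.lintegral_comp (by fun_prop), lintegral_prod _ (by fun_prop)]
  refine lintegral_congr fun t => ?_
  simp only [Function.comp, Prod.swap_prod_mk, Function.update_self]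
  by_cases ht : t ∈ S <;> simp [ht]

/-- If the cost is bounded, so are measurable potentials: `exp (-φ i)` is the conditional integral
of a function that is, up to bounded factors, independent of the `i`-th coordinate. -/
lemma IsCouplingDensity.exists_bound_potential (hf : IsCouplingDensity m f) (hc0 : ∀ θ, 0 ≤ c θ)
    {K : ℝ} (hcK : ∀ θ, c θ ≤ K) {φ : ∀ i, Θ i → ℝ} (hφ : ∀ i, Measurable (φ i))
    (h : ∀ᵐ θ ∂Measure.pi m, f θ = Real.exp (∑ i, φ i (θ i) - c θ)) (i : Fin D) :
    ∃ C, ∀ᵐ t ∂m i, |φ i t| ≤ C := by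
  have hmp := (measurePreserving_update m i).comp
    (Measure.measurePreserving_swap (μ := m i) (ν := Measure.pi m))
  have h1 := Measure.ae_ae_of_ae_prod (hmp.quasiMeasurePreserving.ae h)
  set R : (∀ j, Θ j) → ℝ := fun θ => ∑ j ∈ Finset.univ.erase i, φ j (θ j) with hR
  have hRm : Measurable R := by fun_prop
  set W : ℝ≥0∞ := ∫⁻ θ, ENNReal.ofReal (Real.exp (R θ)) ∂Measure.pi m with hW
  have key : ∀ᵐ t ∂m i, ENNReal.ofReal (Real.exp (φ i t - K)) * W ≤ 1 ∧
      1 ≤ ENNReal.ofReal (Real.exp (φ i t)) * W := by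
    filter_upwards [h1, hf.ae_lintegral_update_eq_one i] with t ht ht1
    have h2 : ∀ᵐ θ ∂Measure.pi m, f (Function.update θ i t)
        = Real.exp (φ i t + R θ - c (Function.update θ i t)) := by
      filter_upwards [ht] with θ hθ
      simp only [Function.comp, Prod.swap_prod_mk] at hθ
      rw [hθ, ← Finset.add_sum_erase _ _ (Finset.mem_univ i), Function.update_self,
        Finset.sum_congr rfl (fun j hj => by
          rw [Function.update_of_ne (Finset.ne_of_mem_erase hj)])]
    rw [hW, ← lintegral_const_mul _ (by fun_prop), ← lintegral_const_mul _ (by fun_prop)]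
    constructor
    · rw [← ht1]
      refine lintegral_mono_ae ?_
      filter_upwards [h2] with θ hθ
      rw [hθ, ← ENNReal.ofReal_mul (Real.exp_pos _).le, ← Real.exp_add]
      refine ENNReal.ofReal_le_ofReal (Real.exp_le_exp.2 ?_)
      linarith [hcK (Function.update θ i t)]
    · nth_rewrite 1 [← ht1]
      refine lintegral_mono_ae ?_
      filter_upwards [h2] with θ hθ
      rw [hθ, ← ENNReal.ofReal_mul (Real.exp_pos _).le, ← Real.exp_add]
      refine ENNReal.ofReal_le_ofReal (Real.exp_le_exp.2 ?_)
      linarith [hc0 (Function.update θ i t)]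
  obtain ⟨t₀, h3, h4⟩ := key.exists
  have hW0 : W ≠ 0 := by
    rintro h0
    simp [h0] at h4
  have hWtop : W ≠ ⊤ := by
    rintro h0
    rw [h0, ENNReal.mul_top (by simp [Real.exp_pos])] at h3
    exact absurd h3 (by simp)
  have hw : 0 < W.toReal := ENNReal.toReal_pos hW0 hWtop
  refine ⟨|Real.log W.toReal| + |K|, ?_⟩
  filter_upwards [key] with t ht
  rw [← ENNReal.ofReal_toReal hWtop, ← ENNReal.ofReal_mul (Real.exp_pos _).le,
    ← ENNReal.ofReal_mul (Real.exp_pos _).le, ENNReal.ofReal_le_one, ENNReal.one_le_ofReal,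
    ← Real.exp_log hw, ← Real.exp_add, ← Real.exp_add, Real.exp_le_one_iff,
    Real.one_le_exp_iff] at ht
  have h5 := abs_le.1 (le_refl |Real.log W.toReal|)
  have h6 := abs_le.1 (le_refl |K|)
  rw [abs_le]
  constructor <;> linarith [ht.1, ht.2]

/-! ### Sufficiency of the Schrödinger equations -/

/-- Densities with integrable potentials are optimal: `∑ i, φ i` has the same integral against all
couplings, and it is the first variation of the convex energy. -/
lemma IsCouplingDensity.isOptimalDensity [NeZero D] (hc : Measurable c) (hc0 : ∀ θ, 0 ≤ c θ)
    (hf : IsCouplingDensity m f) {φ : ∀ i, Θ i → ℝ} (hφ : ∀ i, Integrable (φ i) (m i))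
    (h : ∀ᵐ θ ∂Measure.pi m, f θ = Real.exp (∑ i, φ i (θ i) - c θ)) :
    IsOptimalDensity m c f := by
  have hk := measurable_klFun
  have hsumi : ∀ g, IsCouplingDensity m g →
      Integrable (fun θ => (∑ i, φ i (θ i)) * g θ + 1 - f θ) (Measure.pi m) ∧
      ∫ θ, ((∑ i, φ i (θ i)) * g θ + 1 - f θ) ∂Measure.pi m = ∑ i, ∫ t, φ i t ∂m i := by
    intro g hg
    have h1 : Integrable (fun θ => (∑ i, φ i (θ i)) * g θ) (Measure.pi m) := by
      simp_rw [Finset.sum_mul]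
      exact integrable_finsetSum _ fun i _ => hg.integrable_comp_eval_mul (hφ i)
    have h2 : Integrable (fun θ => (∑ i, φ i (θ i)) * g θ + 1) (Measure.pi m) :=
      h1.add (integrable_const 1)
    refine ⟨h2.sub hf.integrable, ?_⟩
    rw [integral_sub h2 hf.integrable, integral_add h1 (integrable_const 1), hf.integral_eq_one]
    simp_rw [Finset.sum_mul]
    rw [integral_finsetSum _ fun i _ => hg.integrable_comp_eval_mul (hφ i)]
    simp only [integral_const, probReal_univ, one_smul, add_sub_cancel_right]
    exact Finset.sum_congr rfl fun i _ => hg.integral_comp_eval_mul (hφ i)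
  have hval : energy m c f = ENNReal.ofReal (∑ i, ∫ t, φ i t ∂m i) := by
    have h1 : (fun θ => c θ * f θ + klFun (f θ))
        =ᵐ[Measure.pi m] fun θ => (∑ i, φ i (θ i)) * f θ + 1 - f θ := by
      filter_upwards [h] with θ hθ
      have : Real.log (f θ) = ∑ i, φ i (θ i) - c θ := by rw [hθ, Real.log_exp]
      rw [klFun_apply, this]
      ring
    rw [← (hsumi f hf).2, ← integral_congr_ae h1, ofReal_integral_eq_lintegral_ofReal
      ((hsumi f hf).1.congr h1.symm) (ae_of_all _ fun θ =>
        add_nonneg (mul_nonneg (hc0 θ) (hf.nonneg θ)) (klFun_nonneg (hf.nonneg θ)))]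
    rfl
  refine ⟨hf, by rw [hval]; exact ENNReal.ofReal_ne_top, fun g hg => ?_⟩
  by_cases htop : energy m c g = ⊤
  · rw [htop]; exact le_top
  have hgm := hg.measurable
  have hg0 : ∀ θ, 0 ≤ c θ * g θ + klFun (g θ) := fun θ =>
    add_nonneg (mul_nonneg (hc0 θ) (hg.nonneg θ)) (klFun_nonneg (hg.nonneg θ))
  have hgi : Integrable (fun θ => c θ * g θ + klFun (g θ)) (Measure.pi m) := by
    refine ⟨by fun_prop, ?_⟩
    rw [hasFiniteIntegral_iff_ofReal (ae_of_all _ hg0)]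
    exact (Ne.lt_top htop)
  rw [hval, energy, ← ofReal_integral_eq_lintegral_ofReal hgi (ae_of_all _ hg0), ← (hsumi g hg).2]
  refine ENNReal.ofReal_le_ofReal (integral_mono_ae (hsumi g hg).1 hgi ?_)
  filter_upwards [h] with θ hθ
  have hpos : 0 < f θ := by rw [hθ]; exact Real.exp_pos _
  have h1 : Real.log (f θ) = ∑ i, φ i (θ i) - c θ := by rw [hθ, Real.log_exp]
  have h2 := klFun_tangent_le (hg.nonneg θ) hpos
  rw [klFun_apply (f θ), h1] at h2
  linarith

/-- For at most two summands, a sum of arctangents has the sign of the sum. This fails for three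
summands. -/
lemma sum_arctan_pos (hD : D ≤ 2) (a : Fin D → ℝ) (h : 0 < ∑ i, a i) :
    0 < ∑ i, Real.arctan (a i) := by
  interval_cases D
  · simp at h
  · simpa using h
  · simp only [Fin.sum_univ_two] at h ⊢
    have h1 : -a 1 < a 0 := by linarith
    have h2 := Real.arctan_strictMono h1
    rw [Real.arctan_neg] at h2
    linarith

/-- For at most two marginals, a coupling density is determined by the Schrödinger equations, with
no integrability of the potentials: the bounded function `∑ i, arctan (φ i - ψ i)` has the same
integral against both couplings and the same sign as the difference of their densities. -/
lemma IsCouplingDensity.ae_eq_of_le_two [NeZero D] (hD : D ≤ 2) (hf : IsCouplingDensity m f)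
    (hg : IsCouplingDensity m g) {φ ψ : ∀ i, Θ i → ℝ} (hφ : ∀ i, Measurable (φ i))
    (hψ : ∀ i, Measurable (ψ i))
    (hfφ : ∀ᵐ θ ∂Measure.pi m, f θ = Real.exp (∑ i, φ i (θ i) - c θ))
    (hgψ : ∀ᵐ θ ∂Measure.pi m, g θ = Real.exp (∑ i, ψ i (θ i) - c θ)) :
    f =ᵐ[Measure.pi m] g := by
  have hbi : ∀ i, Integrable (fun t => Real.arctan (φ i t - ψ i t)) (m i) := by
    intro i
    refine Integrable.of_bound (Real.measurable_arctan.comp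
      ((hφ i).sub (hψ i))).aestronglyMeasurable (Real.pi / 2) (ae_of_all _ fun t => ?_)
    rw [Real.norm_eq_abs, abs_le]
    exact ⟨(Real.neg_pi_div_two_lt_arctan _).le, (Real.arctan_lt_pi_div_two _).le⟩
  have hint : ∀ g, IsCouplingDensity m g →
      Integrable (fun θ => (∑ i, Real.arctan (φ i (θ i) - ψ i (θ i))) * g θ) (Measure.pi m) ∧
      ∫ θ, (∑ i, Real.arctan (φ i (θ i) - ψ i (θ i))) * g θ ∂Measure.pi m
        = ∑ i, ∫ t, Real.arctan (φ i t - ψ i t) ∂m i := by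
    intro g hg
    simp_rw [Finset.sum_mul]
    refine ⟨integrable_finsetSum _ fun i _ => hg.integrable_comp_eval_mul (hbi i), ?_⟩
    rw [integral_finsetSum _ fun i _ => hg.integrable_comp_eval_mul (hbi i)]
    exact Finset.sum_congr rfl fun i _ => hg.integral_comp_eval_mul (hbi i)
  have hsign : ∀ᵐ θ ∂Measure.pi m,
      0 ≤ (∑ i, Real.arctan (φ i (θ i) - ψ i (θ i))) * (f θ - g θ) ∧
      ((∑ i, Real.arctan (φ i (θ i) - ψ i (θ i))) * (f θ - g θ) = 0 → f θ = g θ) := by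
    filter_upwards [hfφ, hgψ] with θ h1 h2
    have h3 : ∑ i, (φ i (θ i) - ψ i (θ i)) = ∑ i, φ i (θ i) - ∑ i, ψ i (θ i) :=
      Finset.sum_sub_distrib _ _
    rcases lt_trichotomy (∑ i, (φ i (θ i) - ψ i (θ i))) 0 with h4 | h4 | h4
    · have h5 : f θ - g θ < 0 := by
        rw [h1, h2, sub_neg]
        exact Real.exp_lt_exp.2 (by linarith)
      have h6 := sum_arctan_pos hD (fun i => -(φ i (θ i) - ψ i (θ i)))
        (by rw [Finset.sum_neg_distrib]; linarith)
      simp only [Real.arctan_neg, Finset.sum_neg_distrib] at h6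
      have h7 := mul_pos_of_neg_of_neg (neg_pos.1 h6) h5
      exact ⟨h7.le, fun h => absurd h h7.ne'⟩
    · have h5 : f θ = g θ := by
        rw [h1, h2]
        congr 1
        linarith
      simp [h5]
    · have h5 : 0 < f θ - g θ := by
        rw [h1, h2, sub_pos]
        exact Real.exp_lt_exp.2 (by linarith)
      have h7 := mul_pos (sum_arctan_pos hD _ h4) h5
      exact ⟨h7.le, fun h => absurd h h7.ne'⟩
  have hzero : ∫ θ, (∑ i, Real.arctan (φ i (θ i) - ψ i (θ i))) * (f θ - g θ) ∂Measure.pi m = 0 := by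
    simp_rw [mul_sub]
    rw [integral_sub (hint f hf).1 (hint g hg).1, (hint f hf).2, (hint g hg).2, sub_self]
  have hi : Integrable (fun θ => (∑ i, Real.arctan (φ i (θ i) - ψ i (θ i))) * (f θ - g θ))
      (Measure.pi m) := by
    simp_rw [mul_sub]
    exact (hint f hf).1.sub (hint g hg).1
  have h0 := (integral_eq_zero_iff_of_nonneg_ae (hsign.mono fun _ h => h.1) hi).1 hzero
  filter_upwards [hsign, h0] with θ h1 h2
  exact h1.2 h2

/-! ### The inner variational problem in terms of densities -/

/-- The cost of the transport problem with regularization one: `ℓ` changed in sign, normalized, and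
shifted by an upper bound `M` so as to be nonnegative. -/
def cost (ℓ : (∀ i, Θ i) → ℝ) (lam M : ℝ) (θ : ∀ i, Θ i) : ℝ := (M - ℓ θ) / (lam + 1)

lemma extMean_neg_eq {q : Measure (∀ i, Θ i)} [IsProbabilityMeasure q] {ℓ : (∀ i, Θ i) → ℝ}
    (hℓ : Measurable ℓ) {M : ℝ} (hM0 : 0 ≤ M) (hM : ∀ θ, ℓ θ ≤ M) :
    extMean q (fun θ => -ℓ θ)
      = ((∫⁻ θ, ENNReal.ofReal (M - ℓ θ) ∂q : ℝ≥0∞) : EReal) - ((M : ℝ) : EReal) := by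
  unfold extMean
  simp only [neg_neg]
  have h1 : ∫⁻ θ, ENNReal.ofReal (-ℓ θ) ∂q + ENNReal.ofReal M
      = ∫⁻ θ, ENNReal.ofReal (M - ℓ θ) ∂q + ∫⁻ θ, ENNReal.ofReal (ℓ θ) ∂q := by
    have : ENNReal.ofReal M = ∫⁻ _, ENNReal.ofReal M ∂q := by simp
    rw [this, ← lintegral_add_right _ (by fun_prop), ← lintegral_add_right _ (by fun_prop)]
    refine lintegral_congr fun θ => ?_
    have h2 := hM θ
    rcases le_total 0 (ℓ θ) with h | h
    · rw [ENNReal.ofReal_of_nonpos (neg_nonpos.2 h), zero_add,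
        ← ENNReal.ofReal_add (by linarith) h]
      congr 1; ring
    · rw [ENNReal.ofReal_of_nonpos h, add_zero, ← ENNReal.ofReal_add (by linarith) hM0]
      congr 1; ring
  have he : ∫⁻ θ, ENNReal.ofReal (ℓ θ) ∂q ≠ ⊤ := by
    refine ne_top_of_le_ne_top (b := ENNReal.ofReal M) ENNReal.ofReal_ne_top ?_
    calc _ ≤ ∫⁻ _, ENNReal.ofReal M ∂q := lintegral_mono fun θ => ENNReal.ofReal_le_ofReal (hM θ)
      _ = _ := by simp
  generalize ∫⁻ θ, ENNReal.ofReal (-ℓ θ) ∂q = x at h1 ⊢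
  generalize ∫⁻ θ, ENNReal.ofReal (M - ℓ θ) ∂q = y at h1 ⊢
  generalize ∫⁻ θ, ENNReal.ofReal (ℓ θ) ∂q = z at h1 he ⊢
  lift z to NNReal using he
  by_cases hx : x = ⊤
  · subst hx
    have hy : y = ⊤ := by
      by_contra hy
      rw [top_add] at h1
      exact (ENNReal.add_ne_top.2 ⟨hy, ENNReal.coe_ne_top⟩) h1.symm
    subst hy
    have e1 : ((z : ℝ≥0∞) : EReal) = ((z : ℝ) : EReal) := rfl
    rw [EReal.coe_ennreal_top, e1, EReal.top_sub_coe, EReal.top_sub_coe]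
  · have hy : y ≠ ⊤ := by
      rintro rfl
      rw [top_add] at h1
      exact (ENNReal.add_ne_top.2 ⟨hx, ENNReal.ofReal_ne_top⟩) h1
    lift x to NNReal using hx
    lift y to NNReal using hy
    have h2 : (x : ℝ) + M = y + z := by
      have := congrArg ENNReal.toReal h1
      simpa [ENNReal.toReal_add, hM0] using this
    have e1 : ∀ w : NNReal, ((w : ℝ≥0∞) : EReal) = ((w : ℝ) : EReal) := fun _ => rfl
    rw [e1, e1, e1, ← EReal.coe_sub, ← EReal.coe_sub]
    congr 1
    linarith

lemma innerObjective_withDensity [NeZero D] {ℓ : (∀ i, Θ i) → ℝ} (hℓ : Measurable ℓ) {lam M : ℝ}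
    (hlam : 0 ≤ lam) (hM0 : 0 ≤ M) (hM : ∀ θ, ℓ θ ≤ M) (hf : IsCouplingDensity m f) :
    innerObjective m ℓ lam ((Measure.pi m).withDensity fun θ => ENNReal.ofReal (f θ))
      = ((ENNReal.ofReal (lam + 1) * energy m (cost ℓ lam M) f : ℝ≥0∞) : EReal)
        - ((M : ℝ) : EReal) := by
  have hfm := hf.measurable
  have hk := measurable_klFun
  have ha : 0 < lam + 1 := by linarith
  have := hf.isProbabilityMeasure
  have hkl : klDiv ((Measure.pi m).withDensity fun θ => ENNReal.ofReal (f θ)) (Measure.pi m)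
      = ∫⁻ θ, ENNReal.ofReal (klFun (f θ)) ∂Measure.pi m := by
    rw [klDiv_eq_lintegral_klFun_of_ac (withDensity_absolutelyContinuous _ _)]
    refine lintegral_congr_ae ?_
    filter_upwards [Measure.rnDeriv_withDensity (Measure.pi m) hfm.ennreal_ofReal] with θ hθ
    rw [hθ, ENNReal.toReal_ofReal (hf.nonneg θ)]
  unfold innerObjective
  rw [extMean_neg_eq hℓ hM0 hM, hkl, sub_eq_add_neg, add_right_comm, ← EReal.coe_ennreal_add,
    ← sub_eq_add_neg, lintegral_withDensity_eq_lintegral_mul _ hfm.ennreal_ofReal (by fun_prop),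
    energy, ← lintegral_const_mul _ (by fun_prop), ← lintegral_add_right _ (by fun_prop),
    ← lintegral_const_mul _ (by unfold cost; fun_prop)]
  congr 2
  refine lintegral_congr fun θ => ?_
  have h0 := hf.nonneg θ
  have h1 : 0 ≤ M - ℓ θ := by linarith [hM θ]
  have h2 := klFun_nonneg h0
  simp only [Pi.mul_apply]
  rw [← ENNReal.ofReal_mul h0, ← ENNReal.ofReal_mul ha.le, ← ENNReal.ofReal_mul ha.le,
    ← ENNReal.ofReal_add (by positivity) (by positivity), cost]
  congr 1
  field_simp

omit [∀ i, IsProbabilityMeasure (m i)] in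
/-- Couplings that are not absolutely continuous have infinite objective. -/
lemma innerObjective_eq_top {ℓ : (∀ i, Θ i) → ℝ} (hℓ : Measurable ℓ) {lam M : ℝ}
    (hlam : 0 ≤ lam) (hM0 : 0 ≤ M) (hM : ∀ θ, ℓ θ ≤ M) {q : Measure (∀ i, Θ i)}
    [IsProbabilityMeasure q] (hq : ¬ q ≪ Measure.pi m) : innerObjective m ℓ lam q = ⊤ := by
  have ha : 0 < lam + 1 := by linarith
  unfold innerObjective
  rw [klDiv_of_not_ac hq, ENNReal.mul_top (by simpa using ha), extMean_neg_eq hℓ hM0 hM,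
    EReal.coe_ennreal_top, EReal.add_top_of_ne_bot]
  rw [sub_eq_add_neg, ← EReal.coe_neg]
  simp [EReal.add_eq_bot_iff]

end

section

variable {D : ℕ} {Θ : Fin D → Type*} [∀ i, MeasurableSpace (Θ i)]
  {m : ∀ i, Measure (Θ i)} [∀ i, IsProbabilityMeasure (m i)] {f : (∀ i, Θ i) → ℝ}
  {ℓ : (∀ i, Θ i) → ℝ} {lam M : ℝ}

lemma measurable_cost (hℓ : Measurable ℓ) : Measurable (cost ℓ lam M) :=
  (measurable_const.sub hℓ).div_const _

omit [∀ i, MeasurableSpace (Θ i)] in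
lemma cost_nonneg (hlam : 0 ≤ lam) (hM : ∀ θ, ℓ θ ≤ M) (θ : ∀ i, Θ i) : 0 ≤ cost ℓ lam M θ :=
  div_nonneg (by linarith [hM θ]) (by linarith)

lemma innerObjective_le_iff [NeZero D] (hℓ : Measurable ℓ) (hlam : 0 ≤ lam) (hM0 : 0 ≤ M)
    (hM : ∀ θ, ℓ θ ≤ M) {g : (∀ i, Θ i) → ℝ} (hf : IsCouplingDensity m f)
    (hg : IsCouplingDensity m g) :
    innerObjective m ℓ lam ((Measure.pi m).withDensity fun θ => ENNReal.ofReal (f θ))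
        ≤ innerObjective m ℓ lam ((Measure.pi m).withDensity fun θ => ENNReal.ofReal (g θ)) ↔
      energy m (cost ℓ lam M) f ≤ energy m (cost ℓ lam M) g := by
  rw [innerObjective_withDensity hℓ hlam hM0 hM hf, innerObjective_withDensity hℓ hlam hM0 hM hg]
  have ha : ENNReal.ofReal (lam + 1) ≠ 0 := by
    simp only [ne_eq, ENNReal.ofReal_eq_zero, not_le]
    linarith
  constructor
  · intro h
    have h1 := add_le_add_left h ((M : ℝ) : EReal)
    rw [EReal.sub_add_cancel, EReal.sub_add_cancel, EReal.coe_ennreal_le_coe_ennreal_iff] at h1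
    exact (ENNReal.mul_le_mul_iff_right ha ENNReal.ofReal_ne_top).1 h1
  · intro h
    exact EReal.sub_le_sub (EReal.coe_ennreal_le_coe_ennreal_iff.2 (mul_le_mul_right h _)) le_rfl

lemma IsOptimalDensity.isInnerMinimizer [NeZero D] (hℓ : Measurable ℓ) (hlam : 0 ≤ lam)
    (hM0 : 0 ≤ M) (hM : ∀ θ, ℓ θ ≤ M) (hf : IsOptimalDensity m (cost ℓ lam M) f) :
    IsInnerMinimizer m ℓ lam ((Measure.pi m).withDensity fun θ => ENNReal.ofReal (f θ)) := by
  refine ⟨hf.withDensity_mem_couplings, fun q hq => ?_⟩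
  have := hq.1
  by_cases hac : q ≪ Measure.pi m
  · obtain ⟨hg, hgq⟩ := coupling_eq_withDensity hq hac
    rw [Set.mem_ofPred_eq, ← hgq]
    exact (innerObjective_le_iff hℓ hlam hM0 hM hf.toIsCouplingDensity hg).2 (hf.energy_le _ hg)
  · rw [Set.mem_ofPred_eq, innerObjective_eq_top hℓ hlam hM0 hM hac]
    exact le_top

/-- A minimizer of the inner problem is absolutely continuous, with an optimal density, if there is
an optimal density at all. -/
lemma IsInnerMinimizer.exists_density [NeZero D] (hℓ : Measurable ℓ) (hlam : 0 ≤ lam)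
    (hM0 : 0 ≤ M) (hM : ∀ θ, ℓ θ ≤ M) (hf : IsOptimalDensity m (cost ℓ lam M) f)
    {q : Measure (∀ i, Θ i)} (hq : IsInnerMinimizer m ℓ lam q) :
    ∃ g, IsOptimalDensity m (cost ℓ lam M) g ∧
      ((Measure.pi m).withDensity fun θ => ENNReal.ofReal (g θ)) = q := by
  have := hq.1.1
  have hle := hq.2 hf.withDensity_mem_couplings
  rw [Set.mem_ofPred_eq] at hle
  have hac : q ≪ Measure.pi m := by
    by_contra hac
    rw [innerObjective_eq_top hℓ hlam hM0 hM hac, top_le_iff,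
      innerObjective_withDensity hℓ hlam hM0 hM hf.toIsCouplingDensity] at hle
    have h1 : ENNReal.ofReal (lam + 1) * energy m (cost ℓ lam M) f ≠ ⊤ :=
      ENNReal.mul_ne_top ENNReal.ofReal_ne_top hf.energy_ne_top
    lift ENNReal.ofReal (lam + 1) * energy m (cost ℓ lam M) f to NNReal using h1 with x
    have e1 : ((x : ℝ≥0∞) : EReal) = ((x : ℝ) : EReal) := rfl
    rw [e1, ← EReal.coe_sub] at hle
    exact EReal.coe_ne_top _ hle
  obtain ⟨hg, hgq⟩ := coupling_eq_withDensity hq.1 hac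
  rw [← hgq, innerObjective_le_iff hℓ hlam hM0 hM hg hf.toIsCouplingDensity] at hle
  exact ⟨_, ⟨hg, ne_top_of_le_ne_top hf.energy_ne_top hle,
    fun h hh => hle.trans (hf.energy_le h hh)⟩, hgq⟩

/-- The potentials for the likelihood and those for the normalized cost differ by a constant. -/
lemma hasPotentials_withDensity_iff [NeZero D] (hf : IsCouplingDensity m f) {φ : ∀ i, Θ i → ℝ} :
    HasPotentials m ℓ lam ((Measure.pi m).withDensity fun θ => ENNReal.ofReal (f θ)) φ ↔
      ∀ᵐ θ ∂Measure.pi m,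
        f θ = Real.exp (∑ i, (φ i (θ i) + M / (lam + 1) / D) - cost ℓ lam M θ) := by
  have hD : (D : ℝ) ≠ 0 := by exact_mod_cast NeZero.ne D
  have hr := Measure.rnDeriv_withDensity (Measure.pi m) hf.measurable.ennreal_ofReal
  have hexp : ∀ θ, ∑ i, (φ i (θ i) + M / (lam + 1) / D) - cost ℓ lam M θ
      = ∑ i, φ i (θ i) + 1 / (lam + 1) * ℓ θ := by
    intro θ
    rw [Finset.sum_add_distrib, Finset.sum_const, Finset.card_univ, Fintype.card_fin, nsmul_eq_mul,
      mul_div_cancel₀ _ hD, cost]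
    ring
  simp only [hexp]
  constructor
  · intro h
    filter_upwards [hr, h.2] with θ h1 h2
    rw [h1] at h2
    rwa [ENNReal.ofReal_eq_ofReal_iff (hf.nonneg θ) (Real.exp_pos _).le] at h2
  · intro h
    refine ⟨withDensity_absolutelyContinuous _ _, ?_⟩
    filter_upwards [hr, h] with θ h1 h2
    rw [h1, h2]

lemma HasPotentials.eqUpToConstants {q : Measure (∀ i, Θ i)} {φ ψ : ∀ i, Θ i → ℝ}
    (hφ : HasPotentials m ℓ lam q φ) (hψ : HasPotentials m ℓ lam q ψ) :
    EqUpToConstants m φ ψ := by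
  obtain ⟨k, hk, h⟩ := exists_const_of_sum_eq_zero (m := m)
    (d := fun i t => φ i t - ψ i t) (by
      filter_upwards [hφ.2, hψ.2] with θ h1 h2
      rw [h1, ENNReal.ofReal_eq_ofReal_iff (Real.exp_pos _).le (Real.exp_pos _).le,
        Real.exp_eq_exp] at h2
      rw [Finset.sum_sub_distrib]
      linarith)
  refine ⟨k, hk, fun i => ?_⟩
  filter_upwards [h i] with t ht
  linarith

/-- Potentials are almost everywhere equal to measurable functions. -/
lemma exists_measurable_potentials {c : (∀ i, Θ i) → ℝ} (hc : Measurable c)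
    (hf : Measurable f) {φ : ∀ i, Θ i → ℝ}
    (h : ∀ᵐ θ ∂Measure.pi m, f θ = Real.exp (∑ i, φ i (θ i) - c θ)) :
    ∃ ψ : ∀ i, Θ i → ℝ, (∀ i, Measurable (ψ i)) ∧ (∀ i, φ i =ᵐ[m i] ψ i) ∧
      ∀ᵐ θ ∂Measure.pi m, f θ = Real.exp (∑ i, ψ i (θ i) - c θ) := by
  obtain ⟨ψ, hψ, hφψ⟩ := exists_measurable_of_sum_eq (m := m) (φ := φ)
    (Z := fun θ => Real.log (f θ) + c θ) (by fun_prop) (by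
      filter_upwards [h] with θ hθ
      rw [hθ, Real.log_exp]
      ring)
  refine ⟨ψ, hψ, hφψ, ?_⟩
  have h1 : ∀ᵐ θ ∂Measure.pi m, ∀ i, φ i (θ i) = ψ i (θ i) := ae_all_iff.2 fun i =>
    (Measure.quasiMeasurePreserving_eval m i).ae (hφψ i)
  filter_upwards [h, h1] with θ h2 h3
  rw [h2]
  simp only [h3]

/-- Potentials of a coupling are bounded if the likelihood is bounded. -/
lemma HasPotentials.memLp_top [NeZero D] (hℓ : Measurable ℓ) (hlam : 0 ≤ lam) (hM : ∀ θ, ℓ θ ≤ M)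
    (hbelow : BddBelow (Set.range ℓ)) {φ : ∀ i, Θ i → ℝ} (hf : IsCouplingDensity m f)
    (h : HasPotentials m ℓ lam ((Measure.pi m).withDensity fun θ => ENNReal.ofReal (f θ)) φ)
    (i : Fin D) : MemLp (φ i) ⊤ (m i) := by
  obtain ⟨L, hL⟩ := hbelow
  have hL' : ∀ θ, L ≤ ℓ θ := fun θ => hL ⟨θ, rfl⟩
  obtain ⟨ψ, hψ, hφψ, hfψ⟩ := exists_measurable_potentials
    (φ := fun i t => φ i t + M / (lam + 1) / D) (measurable_cost hℓ) hf.measurable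
    ((hasPotentials_withDensity_iff (M := M) hf).1 h)
  obtain ⟨C, hC⟩ := hf.exists_bound_potential (cost_nonneg hlam hM) (K := (M - L) / (lam + 1))
    (fun θ => div_le_div_of_nonneg_right (by linarith [hL' θ]) (by linarith)) hψ hfψ i
  have h1 : MemLp (ψ i) ⊤ (m i) := memLp_top_of_bound (hψ i).aestronglyMeasurable C hC
  generalize M / (lam + 1) / (D : ℝ) = k at hφψ
  have h2 : MemLp (fun t => ψ i t - k) ⊤ (m i) := h1.sub (memLp_const k)
  refine h2.ae_eq ?_
  filter_upwards [hφψ i] with t ht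
  rw [← ht, add_sub_cancel_right]

end

end XiVI

end

theorem theoremC1 {D : ℕ} (hD : 1 ≤ D)
    {Θ : Fin D → Type*} [∀ i, MeasurableSpace (Θ i)]
    (m : ∀ i, Measure (Θ i)) [∀ i, IsProbabilityMeasure (m i)]
    (ℓ : (∀ i, Θ i) → ℝ) (hℓ : Measurable ℓ)
    (lam : ℝ) (hlam : 0 ≤ lam)
    (hfin : (⨅ q ∈ XiVI.couplings m,
      (XiVI.extMean q (fun θ => -ℓ θ)
        + ((ENNReal.ofReal (lam + 1) * XiVI.expressivity q : ℝ≥0∞) : EReal))) < ⊤)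
    (hbdd : BddAbove (Set.range ℓ)) :
    ∃ (qs : Measure (∀ i, Θ i)) (φs : ∀ i, Θ i → ℝ),
      -- existence and uniqueness of the minimizer
      XiVI.IsInnerMinimizer m ℓ lam qs ∧
      (∀ q, XiVI.IsInnerMinimizer m ℓ lam q → q = qs) ∧
      qs ≪ Measure.pi m ∧
      -- measurable potentials
      (∀ i, Measurable (φs i)) ∧
      XiVI.HasPotentials m ℓ lam qs φs ∧
      -- uniqueness of the potentials up to additive constants
      (∀ φ : ∀ i, Θ i → ℝ, XiVI.HasPotentials m ℓ lam qs φ → XiVI.EqUpToConstants m φ φs) ∧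
      -- boundedness of the potentials
      (BddBelow (Set.range ℓ) →
        ∀ φ : ∀ i, Θ i → ℝ, XiVI.HasPotentials m ℓ lam qs φ → ∀ i, MemLp (φ i) ⊤ (m i)) ∧
      -- converse
      (∀ q ∈ XiVI.couplings m, ∀ φ : ∀ i, Θ i → ℝ, XiVI.HasPotentials m ℓ lam q φ →
        ((∀ i, Integrable (φ i) (m i)) ∨ BddBelow (Set.range ℓ) ∨ D ≤ 2) →
        XiVI.IsInnerMinimizer m ℓ lam q ∧ XiVI.EqUpToConstants m φ φs) := by
  have : NeZero D := ⟨by omega⟩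
  obtain ⟨M₀, hM₀⟩ := hbdd
  -- an upper bound of the likelihood, nonnegative for convenience
  obtain ⟨M, hM0, hM⟩ : ∃ M : ℝ, 0 ≤ M ∧ ∀ θ, ℓ θ ≤ M :=
    ⟨max M₀ 0, le_max_right _ _, fun θ => (hM₀ ⟨θ, rfl⟩).trans (le_max_left _ _)⟩
  have hc := XiVI.measurable_cost (lam := lam) (M := M) hℓ
  have hc0 := XiVI.cost_nonneg hlam hM
  obtain ⟨g, hg, hgfin⟩ : ∃ g, XiVI.IsCouplingDensity m g ∧
      XiVI.energy m (XiVI.cost ℓ lam M) g ≠ ⊤ := by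
    simp only [iInf_lt_iff] at hfin
    obtain ⟨q, hq, hlt⟩ := hfin
    have := hq.1
    have hmarg : XiVI.marginal q = m := funext hq.2
    rw [XiVI.expressivity, hmarg] at hlt
    change XiVI.innerObjective m ℓ lam q < ⊤ at hlt
    have hac : q ≪ Measure.pi m := by
      by_contra hac
      rw [XiVI.innerObjective_eq_top hℓ hlam hM0 hM hac] at hlt
      exact lt_irrefl _ hlt
    obtain ⟨hg, hgq⟩ := XiVI.coupling_eq_withDensity hq hac
    refine ⟨_, hg, fun htop => ?_⟩
    rw [← hgq, XiVI.innerObjective_withDensity hℓ hlam hM0 hM hg, htop,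
      ENNReal.mul_top (by simp only [ne_eq, ENNReal.ofReal_eq_zero, not_le]; linarith),
      EReal.coe_ennreal_top, EReal.top_sub_coe] at hlt
    exact lt_irrefl _ hlt
  obtain ⟨f, hf⟩ := XiVI.exists_isOptimalDensity hc hc0 hg hgfin
  obtain ⟨ψ, hψm, hψ⟩ := hf.exists_potentials hc hc0
  have huniq : ∀ q, XiVI.IsInnerMinimizer m ℓ lam q →
      q = (Measure.pi m).withDensity fun θ => ENNReal.ofReal (f θ) := by
    intro q hq
    obtain ⟨g, hg, rfl⟩ := hq.exists_density hℓ hlam hM0 hM hf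
    refine withDensity_congr_ae ?_
    filter_upwards [hg.ae_eq hc hc0 hf] with θ hθ
    rw [hθ]
  have hpot : XiVI.HasPotentials m ℓ lam
      ((Measure.pi m).withDensity fun θ => ENNReal.ofReal (f θ))
      (fun i t => ψ i t - M / (lam + 1) / D) := by
    refine (XiVI.hasPotentials_withDensity_iff (M := M) hf.toIsCouplingDensity).2 ?_
    simpa only [sub_add_cancel] using hψ
  refine ⟨(Measure.pi m).withDensity fun θ => ENNReal.ofReal (f θ),
    fun i t => ψ i t - M / (lam + 1) / D, hf.isInnerMinimizer hℓ hlam hM0 hM, huniq,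
    withDensity_absolutelyContinuous _ _, fun i => (hψm i).sub_const _, hpot,
    fun φ hφ => hφ.eqUpToConstants hpot,
    fun hbelow φ hφ => hφ.memLp_top hℓ hlam hM hbelow hf.toIsCouplingDensity, ?_⟩
  intro q hq φ hφ hcase
  suffices hmin : XiVI.IsInnerMinimizer m ℓ lam q by
    refine ⟨hmin, ?_⟩
    rw [huniq q hmin] at hφ
    exact hφ.eqUpToConstants hpot
  obtain ⟨hg, hgq⟩ := XiVI.coupling_eq_withDensity hq hφ.1
  rw [← hgq] at hφ ⊢
  have hgφ := (XiVI.hasPotentials_withDensity_iff (M := M) hg).1 hφ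
  have hint : (∀ i, Integrable (φ i) (m i)) → XiVI.IsInnerMinimizer m ℓ lam
      ((Measure.pi m).withDensity fun θ =>
        ENNReal.ofReal (q.rnDeriv (Measure.pi m) θ).toReal) := fun hφi =>
    (hg.isOptimalDensity (φ := fun i t => φ i t + M / (lam + 1) / D) hc hc0
      (fun i => (hφi i).add (integrable_const (M / (lam + 1) / (D : ℝ)))) hgφ).isInnerMinimizer
      hℓ hlam hM0 hM
  rcases hcase with hφi | hbelow | hD2
  · exact hint hφi
  · exact hint fun i => (hφ.memLp_top hℓ hlam hM hbelow hg i).integrable le_top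
  · obtain ⟨χ, hχ, -, hgχ⟩ := XiVI.exists_measurable_potentials
      (φ := fun i t => φ i t + M / (lam + 1) / D) hc hg.measurable hgφ
    have hgf := hg.ae_eq_of_le_two hD2 hf.toIsCouplingDensity hχ hψm hgχ hψ
    have : ((Measure.pi m).withDensity fun θ =>
        ENNReal.ofReal (q.rnDeriv (Measure.pi m) θ).toReal)
        = (Measure.pi m).withDensity fun θ => ENNReal.ofReal (f θ) := by
      refine withDensity_congr_ae ?_
      filter_upwards [hgf] with θ hθ
      rw [hθ]
    rw [this]
    exact hf.isInnerMinimizer hℓ hlam hM0 hM
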